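/- Let $n,p$ be positive integers. Let $\mathcal{C}\ell_p$ be the complex Clifford algebra with generators $e_1,\dots,e_p$, $e_\alpha e_\beta+e_\beta e_\alpha=2\delta_{\alpha,\beta}$, and let $\mathcal{A}=\mathbb{C}[x_{i,\alpha}: 1\le i\le n,\ 1\le\alpha\le p]\otimes\mathcal{C}\ell_p$. The monomials $x^\gamma e^\eta=\prod_{i,\alpha}x_{i,\alpha}^{\gamma_{i,\alpha}}\, e_1^{\eta_1}\cdots e_p^{\eta_p}$, with $\gamma\in M_{n,p}(\mathbb{N}_0)$ and $\eta\in\{0,1\}^p$, form a basis of $\mathcal{A}$; let $\langle\cdot,\cdot\rangle$ be the inner product on $\mathcal{A}$, linear in the second argument, for which this basis is orthonormal. The odd generators $B_i^+,B_i^-$ ($1\le i\le n$) of the Lie superalgebra $\mathfrak{osp}(1|2n)$ act on $\mathcal{A}$ by $X_i=\sum_\alpha x_{i,\alpha}e_\alpha$ and $D_i=\sum_\alpha\partial_{x_{i,\alpha}}e_\alpha$ (with $e_\alpha$ acting by left multiplication). Let $L_n(p)\subseteq\mathcal{A}$ be the submodule generated by $1$, and for $\mu\in\mathbb{N}_0^n$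 let $L_n(p)_{\mu+p/2}$ be the space of all $v\in L_n(p)$ with $\tfrac12(X_iD_i+D_iX_i)v=(\mu_i+\tfrac p2)v$ for all $i$; put $d_\mu=\dim L_n(p)_{\mu+p/2}$. Let $\mathbb{Y}_n(p)$ be the set of semistandard Young tableaux with entries in $\{1,\dots,n\}$ and at most $p$ rows. For $A\in\mathbb{Y}_n(p)$ let $\lambda_A$ be its shape, $\mu_A\in\mathbb{N}_0^n$ its weight ($(\mu_A)_i$ is the number of entries $i$), and $A^k$ the subtableau of the entries $\le k$. Order $\mathbb{Y}_n(p)$ by: $A<B$ if $\mu_A<\mu_B$, or if $\mu_A=\mu_B$ and for some $k\in\{1,\dots,n\}$ one has $\lambda_{A^l}=\lambda_{B^l}$ for all $l<k$ and $\lambda_{A^k}<\lambda_{B^k}$; here elements of $\mathbb{N}_0^n$ and partitions are compared in the graded lexicographic order (first by the sum of the parts, then by the first part that differs). For $i_1<\dots<i_k$ put $X_{(i_1,\dots,i_k)}=\sum_{\sigma\in S_k}\operatorname{sgn}(\sigma)X_{i_{\sigma(1)}}\cdots X_{i_{\sigma(k)}}$. If $a_1,\dots,a_m$ are the columns of $A$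 from left to right and $h_1,\dots,h_m$ are their lengths, put $$\tilde\omega_A(p)=\frac{1}{h_1!\cdots h_m!}\,X_{a_m}\cdots X_{a_1}(1)\in L_n(p).$$ The leading term of $\tilde\omega_A(p)$ is $t_A=x_{A,D_A}\,e_{D_A}$, where $x_{A,D_A}$ is the product of $x_{a,k}$ over all boxes of $A$, $a$ being the entry and $k$ the row of the box, and $e_{D_A}=(e_1\cdots e_{h_m})\cdots(e_1\cdots e_{h_1})$. Then the following hold. 1. For every $\mu\in\mathbb{N}_0^n$ there are exactly $d_\mu$ tableaux of weight $\mu$ in $\mathbb{Y}_n(p)$; denote them by $A_1<\dots<A_{d_\mu}$. The $d_\mu\times d_\mu$ matrix $U_\mu$ with entries $(U_\mu)_{k,l}=\langle t_{A_k},\tilde\omega_{A_l}(p)\rangle$ is an integer upper unitriangular matrix. 2. For every $v\in L_n(p)_{\mu+p/2}$, with $f_\mu(v)\in\mathbb{C}^{d_\mu}$ defined by $(f_\mu)_k(v)=\langle t_{A_k},v\rangle$, $$v=\sum_{k=1}^{d_\mu}\big(U_\mu^{-1}f_\mu(v)\big)_k\,\tilde\omega_{A_k}(p)=\sum_{k=1}^{d_\mu}\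 \sum_{t=0}^{d_\mu-k}\ \sum_{k=l_0<l_1<\cdots<l_t\le d_\mu}(-1)^t\Big(\prod_{s=1}^{t}(U_\mu)_{l_{s-1},l_s}\Big)(f_\mu)_{l_t}(v)\,\tilde\omega_{A_k}(p).$$ 3. All generator matrix elements are integers: for all $i\in\{1,\dots,n\}$ and $A\in\mathbb{Y}_n(p)$, each of $X_i\tilde\omega_A(p)$ and $D_i\tilde\omega_A(p)$ is a finite linear combination of the vectors $\tilde\omega_B(p)$, $B\in\mathbb{Y}_n(p)$, with uniquely determined complex coefficients, and these coefficients are integers. -/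

import Mathlib

open scoped TensorProduct

namespace Paraboson

noncomputable section

/-! ### The Clifford algebra and its monomial basis -/

/-- The quadratic form `v ↦ v₁² + ⋯ + v_p²` on `ℂ^p`. -/
def cliffordForm (p : ℕ) : QuadraticForm ℂ (Fin p → ℂ) :=
  QuadraticMap.weightedSumSquares ℂ (fun _ : Fin p => (1 : ℂ))

/-- The complex Clifford algebra with `p` generators `e_α`, `{e_α, e_β} = 2 δ_{αβ}`. -/
abbrev Cl (p : ℕ) : Type := CliffordAlgebra (cliffordForm p)

/-- The generator `e_α`. -/
def e {p : ℕ} (α : Fin p) : Cl p := CliffordAlgebra.ι (cliffordForm p) (Pi.single α 1)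

theorem e_anticomm {p : ℕ} (α β : Fin p) :
    e α * e β + e β * e α = if α = β then 2 else 0 := by
  unfold e
  rw [CliffordAlgebra.ι_mul_ι_add_swap]
  have key : QuadraticMap.polar (cliffordForm p) (Pi.single α 1) (Pi.single β 1)
      = if α = β then 2 else 0 := by
    simp only [QuadraticMap.polar, cliffordForm, QuadraticMap.weightedSumSquares_apply,
      Pi.add_apply, one_smul]
    rw [← Finset.sum_sub_distrib, ← Finset.sum_sub_distrib]
    have : ∀ i : Fin p, ((Pi.single α (1 : ℂ) : Fin p → ℂ) i + (Pi.single β 1 : Fin p → ℂ) i) *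
        ((Pi.single α (1 : ℂ) : Fin p → ℂ) i + (Pi.single β 1 : Fin p → ℂ) i)
        - (Pi.single α (1 : ℂ) : Fin p → ℂ) i * (Pi.single α (1 : ℂ) : Fin p → ℂ) i
        - (Pi.single β (1 : ℂ) : Fin p → ℂ) i * (Pi.single β (1 : ℂ) : Fin p → ℂ) i
        = if i = α then (if α = β then 2 else 0) else 0 := by
      intro i
      by_cases h1 : i = α
      · subst h1
        by_cases h2 : i = β
        · subst h2
          norm_num
        · simp [h2]
      · simp [h1]
    rw [Finset.sum_congr rfl fun i _ => this i]
    simp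
  rw [key]
  split_ifs
  · exact map_ofNat _ 2
  · exact map_zero _

/-- The ordered monomial `e^η = e_1^{η_1} ⋯ e_p^{η_p}`. -/
def cliffordMonomial {p : ℕ} (η : Fin p → ℕ) : Cl p :=
  (List.ofFn fun α => e α ^ η α).prod

/-- Left multiplication by `e_α` in coordinates with respect to the monomials `e^η`, `η ∈ ℤ₂^p`
(an auxiliary operator, used only to show that these monomials are linearly independent). -/
def coordMul {p : ℕ} (α : Fin p) : Module.End ℂ ((Fin p → ZMod 2) → ℂ) where
  toFun f η := (∏ β : Fin p, if β < α then (-1 : ℂ) ^ (η β).val else 1) * f (η + Pi.single α 1)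
  map_add' f g := by ext η; simp [mul_add]
  map_smul' c f := by ext η; simp; ring

theorem coordMul_apply {p : ℕ} (α : Fin p) (f : (Fin p → ZMod 2) → ℂ) (η : Fin p → ZMod 2) :
    coordMul α f η
      = (∏ β : Fin p, if β < α then (-1 : ℂ) ^ (η β).val else 1) * f (η + Pi.single α 1) := rfl

theorem neg_one_pow_val_add_one (a : ZMod 2) :
    (-1 : ℂ) ^ (a + 1).val = - (-1 : ℂ) ^ a.val := by
  fin_cases a
  · have : ((0 : ZMod 2) + 1).val = 1 := by decide
    change (-1 : ℂ) ^ ((0 : ZMod 2) + 1).val = - (-1 : ℂ) ^ (0 : ZMod 2).val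
    rw [this, ZMod.val_zero]; norm_num
  · have : ((1 : ZMod 2) + 1).val = 0 := by decide
    have h1 : (1 : ZMod 2).val = 1 := by decide
    change (-1 : ℂ) ^ ((1 : ZMod 2) + 1).val = - (-1 : ℂ) ^ (1 : ZMod 2).val
    rw [this, h1]; norm_num

theorem sign_shift_ge {p : ℕ} {α β : Fin p} (h : α ≤ β) (η : Fin p → ZMod 2) :
    (∏ γ : Fin p, if γ < α then (-1 : ℂ) ^ ((η + Pi.single β 1 : Fin p → ZMod 2) γ).val else 1)
      = ∏ γ : Fin p, if γ < α then (-1 : ℂ) ^ (η γ).val else 1 := by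
  refine Finset.prod_congr rfl fun γ _ => ?_
  split_ifs with hγ
  · have : γ ≠ β := (lt_of_lt_of_le hγ h).ne
    simp [this]
  · rfl

theorem sign_shift_lt {p : ℕ} {α β : Fin p} (h : β < α) (η : Fin p → ZMod 2) :
    (∏ γ : Fin p, if γ < α then (-1 : ℂ) ^ ((η + Pi.single β 1 : Fin p → ZMod 2) γ).val else 1)
      = - ∏ γ : Fin p, if γ < α then (-1 : ℂ) ^ (η γ).val else 1 := by
  rw [← Finset.mul_prod_erase _ _ (Finset.mem_univ β),
    ← Finset.mul_prod_erase (a := β) _ (fun γ => if γ < α then (-1 : ℂ) ^ (η γ).val else 1)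
      (Finset.mem_univ β)]
  have h2 : ∀ γ ∈ Finset.univ.erase β,
      (if γ < α then (-1 : ℂ) ^ ((η + Pi.single β 1 : Fin p → ZMod 2) γ).val else 1)
        = if γ < α then (-1 : ℂ) ^ (η γ).val else 1 := by
    intro γ hγ
    have : γ ≠ β := Finset.ne_of_mem_erase hγ
    simp [this]
  rw [Finset.prod_congr rfl h2]
  simp only [h, if_true, Pi.add_apply, Pi.single_eq_same, neg_one_pow_val_add_one]
  ring

theorem shift_shift {p : ℕ} (α : Fin p) (η : Fin p → ZMod 2) :
    η + Pi.single α 1 + Pi.single α 1 = η := by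
  rw [add_assoc, ← Pi.single_add]
  have : (1 : ZMod 2) + 1 = 0 := by decide
  simp [this]

theorem coordMul_sq {p : ℕ} (α : Fin p) : coordMul α * coordMul α = 1 := by
  refine LinearMap.ext fun f => funext fun η => ?_
  change coordMul α (coordMul α f) η = f η
  rw [coordMul_apply, coordMul_apply, sign_shift_ge le_rfl, shift_shift, ← mul_assoc,
    ← Finset.prod_mul_distrib, Finset.prod_eq_one, one_mul]
  intro γ _
  split_ifs
  · rw [← mul_pow]; norm_num
  · norm_num

theorem coordMul_anticomm {p : ℕ} {α β : Fin p} (h : α ≠ β) :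
    coordMul α * coordMul β + coordMul β * coordMul α = 0 := by
  wlog hlt : α < β generalizing α β
  · rw [add_comm]
    exact this h.symm (lt_of_le_of_ne (not_lt.mp hlt) h.symm)
  refine LinearMap.ext fun f => funext fun η => ?_
  change coordMul α (coordMul β f) η + coordMul β (coordMul α f) η = 0
  rw [coordMul_apply, coordMul_apply, coordMul_apply, coordMul_apply, sign_shift_lt hlt,
    sign_shift_ge hlt.le, add_right_comm η (Pi.single β 1)]
  ring

/-- The linear combination `∑ v_α (coordMul α)`. -/
def coordLin (p : ℕ) : (Fin p → ℂ) →ₗ[ℂ] Module.End ℂ ((Fin p → ZMod 2) → ℂ) :=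
  Fintype.linearCombination ℂ (fun α : Fin p => coordMul α)

theorem coordLin_sq {p : ℕ} (v : Fin p → ℂ) :
    coordLin p v * coordLin p v = algebraMap ℂ _ (cliffordForm p v) := by
  have h2 : (2 : ℂ) • (coordLin p v * coordLin p v)
      = (2 : ℂ) • algebraMap ℂ (Module.End ℂ ((Fin p → ZMod 2) → ℂ)) (cliffordForm p v) := by
    have e1 : coordLin p v * coordLin p v
        = ∑ α, ∑ β, (v α * v β) • (coordMul α * coordMul β) := by
      simp only [coordLin, Fintype.linearCombination_apply, Finset.sum_mul_sum, smul_mul_smul_comm]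
    have e2 : coordLin p v * coordLin p v
        = ∑ α, ∑ β, (v α * v β) • (coordMul β * coordMul α) := by
      rw [e1, Finset.sum_comm]
      refine Finset.sum_congr rfl fun α _ => Finset.sum_congr rfl fun β _ => ?_
      rw [mul_comm]
    rw [two_smul]
    nth_rewrite 1 [e1]
    rw [e2, ← Finset.sum_add_distrib]
    have e3 : ∀ α : Fin p, (∑ β, (v α * v β) • (coordMul α * coordMul β)
        + ∑ β, (v α * v β) • (coordMul β * coordMul α)) = (2 * (v α * v α)) • 1 := by
      intro α
      rw [← Finset.sum_add_distrib, Finset.sum_eq_single α]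
      · rw [coordMul_sq, ← add_smul]; ring_nf
      · intro β _ hβ
        rw [← smul_add, coordMul_anticomm hβ.symm, smul_zero]
      · simp
    rw [Finset.sum_congr rfl fun α _ => e3 α, ← Finset.sum_smul, ← Finset.mul_sum,
      Algebra.algebraMap_eq_smul_one, smul_smul]
    simp [cliffordForm, QuadraticMap.weightedSumSquares_apply]
  exact smul_right_injective _ (two_ne_zero) h2

/-- The coordinates of an element of the Clifford algebra. -/
def cliffordCoord (p : ℕ) : Cl p →ₗ[ℂ] ((Fin p → ZMod 2) → ℂ) :=
  (LinearMap.applyₗ (Pi.single 0 1)).comp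
    (CliffordAlgebra.lift (cliffordForm p) ⟨coordLin p, coordLin_sq⟩).toLinearMap

theorem coordMul_list {p : ℕ} (η : Fin p → ZMod 2) (l : List (Fin p)) (hl : l.Pairwise (· < ·)) :
    (l.map fun α => coordMul α ^ (η α).val).prod (Pi.single 0 1)
      = Pi.single (fun α => if α ∈ l then η α else 0) 1 := by
  induction l with
  | nil =>
    simp
    rfl
  | cons a l ih =>
    rw [List.pairwise_cons] at hl
    obtain ⟨ha, hl⟩ := hl
    rw [List.map_cons, List.prod_cons, Module.End.mul_apply, ih hl]
    have hal : a ∉ l := fun h => lt_irrefl _ (ha a h)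
    have h01 : η a = 0 ∨ η a = 1 := by
      generalize η a = x
      fin_cases x
      · exact Or.inl rfl
      · exact Or.inr rfl
    rcases h01 with h | h
    · rw [h]
      have : (fun α => if α ∈ a :: l then η α else 0) = fun α => if α ∈ l then η α else 0 := by
        funext α
        by_cases hα : α = a
        · subst hα; simp [hal, h]
        · simp [hα]
      rw [this]
      simp
    · rw [h]
      have h1 : (1 : ZMod 2).val = 1 := by decide
      rw [h1, pow_one]
      have key : (fun α => if α ∈ a :: l then η α else 0)
          = (fun α => if α ∈ l then η α else 0) + Pi.single a 1 := by
        funext α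
        by_cases hα : α = a
        · subst hα; simp [hal, h]
        · simp [hα]
      rw [key]
      funext ζ
      rw [coordMul_apply]
      by_cases hζ : ζ = (fun α => if α ∈ l then η α else 0) + Pi.single a 1
      · rw [hζ, shift_shift, Pi.single_eq_same, Pi.single_eq_same, mul_one]
        refine Finset.prod_eq_one fun γ _ => ?_
        split_ifs with hγ
        · have h3 : γ ∉ l := fun h => lt_asymm hγ (ha γ h)
          have h4 : γ ≠ a := hγ.ne
          simp [h3, h4]
        · rfl
      · have h5 : ζ + Pi.single a 1 ≠ (fun α => if α ∈ l then η α else 0) := by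
          intro h6
          apply hζ
          rw [← h6, shift_shift]
        rw [Pi.single_eq_of_ne h5, Pi.single_eq_of_ne hζ, mul_zero]

theorem cliffordCoord_monomial {p : ℕ} (η : Fin p → ZMod 2) :
    cliffordCoord p (cliffordMonomial fun α => (η α).val) = Pi.single η 1 := by
  have h1 : CliffordAlgebra.lift (cliffordForm p) ⟨coordLin p, coordLin_sq⟩
      (cliffordMonomial fun α => (η α).val)
        = ((List.finRange p).map fun α => coordMul α ^ (η α).val).prod := by
    rw [cliffordMonomial, List.ofFn_eq_map, map_list_prod, List.map_map]
    congr 1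
    refine List.map_congr_left fun α _ => ?_
    simp only [Function.comp, map_pow, e, CliffordAlgebra.lift_ι_apply]
    congr 1
    simp [coordLin]
  change CliffordAlgebra.lift (cliffordForm p) ⟨coordLin p, coordLin_sq⟩
      (cliffordMonomial fun α => (η α).val) (Pi.single 0 1) = _
  rw [h1, coordMul_list η _ (List.pairwise_lt_finRange p)]
  simp

theorem finrank_Cl (p : ℕ) : Module.finrank ℂ (Cl p) = Fintype.card (Fin p → ZMod 2) := by
  rw [(CliffordAlgebra.equivExterior (cliffordForm p)).finrank_eq,
    Module.finrank_eq_card_basis (Module.Basis.ExteriorAlgebra (Pi.basisFun ℂ (Fin p)))]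
  simp [ZMod.card]

theorem linearIndependent_cliffordMonomial (p : ℕ) :
    LinearIndependent ℂ
      (fun η : Fin p → ZMod 2 => cliffordMonomial fun α => (η α).val) := by
  apply LinearIndependent.of_comp (cliffordCoord p)
  have : (cliffordCoord p ∘ fun η : Fin p → ZMod 2 => cliffordMonomial fun α => (η α).val)
      = Pi.basisFun ℂ (Fin p → ZMod 2) := by
    funext η
    simp [cliffordCoord_monomial]
  rw [this]
  exact (Pi.basisFun ℂ (Fin p → ZMod 2)).linearIndependent

/-- The basis `e^η`, `η ∈ ℤ₂^p`, of the Clifford algebra. -/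
def cliffordBasis (p : ℕ) : Module.Basis (Fin p → ZMod 2) ℂ (Cl p) :=
  basisOfLinearIndependentOfCardEqFinrank (linearIndependent_cliffordMonomial p)
    (finrank_Cl p).symm

theorem cliffordBasis_apply {p : ℕ} (η : Fin p → ZMod 2) :
    cliffordBasis p η = cliffordMonomial fun α => (η α).val := by
  simp [cliffordBasis]

/-! ### Clifford algebra valued polynomials -/

/-- The space `𝒜 = ℂ[ℝ^{np}] ⊗ 𝒞ℓ_p`; the variable `x_{i,α}` is `MvPolynomial.X (i, α)`. -/
abbrev CliffPoly (n p : ℕ) : Type := MvPolynomial (Fin n × Fin p) ℂ ⊗[ℂ] Cl p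

/-- The monomial `x^γ = ∏_{i,α} x_{i,α}^{γ_{i,α}}`. -/
def polyMonomial {n p : ℕ} (γ : Fin n × Fin p → ℕ) : MvPolynomial (Fin n × Fin p) ℂ :=
  ∏ i : Fin n, ∏ α : Fin p, MvPolynomial.X (i, α) ^ γ (i, α)

/-- The basis of `𝒜` consisting of the monomials `x^γ e^η`. -/
def monomialBasis (n p : ℕ) :
    Module.Basis ((Fin n × Fin p →₀ ℕ) × (Fin p → ZMod 2)) ℂ (CliffPoly n p) :=
  (MvPolynomial.basisMonomials (Fin n × Fin p) ℂ).tensorProduct (cliffordBasis p)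

theorem monomialBasis_apply {n p : ℕ} (γ : Fin n × Fin p →₀ ℕ) (η : Fin p → ZMod 2) :
    monomialBasis n p (γ, η) = polyMonomial γ ⊗ₜ[ℂ] cliffordMonomial fun α => (η α).val := by
  rw [monomialBasis, Module.Basis.tensorProduct_apply, cliffordBasis_apply,
    MvPolynomial.coe_basisMonomials]
  congr 1
  change MvPolynomial.monomial γ 1 = _
  rw [MvPolynomial.monomial_eq, polyMonomial, Finsupp.prod_fintype _ _ (by simp),
    Fintype.prod_prod_type]
  simp

/-- The inner product on `𝒜` (conjugate-linear in the first argument) for which the monomials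
`x^γ e^η` are orthonormal. -/
def pairing {n p : ℕ} (u v : CliffPoly n p) : ℂ :=
  ((monomialBasis n p).repr u).sum fun b c => (starRingEnd ℂ) c * (monomialBasis n p).repr v b

theorem pairing_monomialBasis {n p : ℕ} (b b' : (Fin n × Fin p →₀ ℕ) × (Fin p → ZMod 2)) :
    pairing (monomialBasis n p b) (monomialBasis n p b') = if b = b' then 1 else 0 := by
  classical
  simp [pairing, Finsupp.single_apply, eq_comm]

/-! ### The action of `osp(1|2n)` and the module `L_n(p)` -/

/-- The action of the odd generator `B_i⁺`: `X_i = ∑_α x_{i,α} e_α`. -/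
def X {n p : ℕ} (i : Fin n) : Module.End ℂ (CliffPoly n p) :=
  ∑ α : Fin p, TensorProduct.map
    (LinearMap.mulLeft ℂ (MvPolynomial.X (i, α) : MvPolynomial (Fin n × Fin p) ℂ))
    (LinearMap.mulLeft ℂ (e α))

/-- The action of the odd generator `B_i⁻`: `D_i = ∑_α ∂_{i,α} e_α`. -/
def D {n p : ℕ} (i : Fin n) : Module.End ℂ (CliffPoly n p) :=
  ∑ α : Fin p, TensorProduct.map
    ((MvPolynomial.pderiv (i, α) :
      Derivation ℂ (MvPolynomial (Fin n × Fin p) ℂ) (MvPolynomial (Fin n × Fin p) ℂ)) :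
        MvPolynomial (Fin n × Fin p) ℂ →ₗ[ℂ] MvPolynomial (Fin n × Fin p) ℂ)
    (LinearMap.mulLeft ℂ (e α))

/-- The constant polynomial `1 ∈ 𝒜`. -/
def vac (n p : ℕ) : CliffPoly n p := 1 ⊗ₜ[ℂ] 1

/-- `L_n(p)`: the smallest subspace of `𝒜` that contains `1` and is stable under the action of
`osp(1|2n)`, that is, under its generators `X_i` and `D_i`. -/
def L (n p : ℕ) : Submodule ℂ (CliffPoly n p) :=
  sInf {W | vac n p ∈ W ∧ ∀ i : Fin n, ∀ w ∈ W, X i w ∈ W ∧ D i w ∈ W}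

/-- The action of the Cartan element `h_i = ½ {B_i⁺, B_i⁻}`. -/
def cartan {n p : ℕ} (i : Fin n) : Module.End ℂ (CliffPoly n p) :=
  (1 / 2 : ℂ) • (X i * D i + D i * X i)

/-- The weight space of `L_n(p)` of weight `μ + p/2 = (μ_1 + p/2, …, μ_n + p/2)`. -/
def weightSpace (n p : ℕ) (μ : Fin n → ℕ) : Submodule ℂ (CliffPoly n p) :=
  L n p ⊓ ⨅ i : Fin n, (cartan i).eigenspace ((μ i : ℂ) + (p : ℂ) / 2)

/-- `d_μ = dim L_n(p)_{μ + p/2}`. -/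
def dimWeight (n p : ℕ) (μ : Fin n → ℕ) : ℕ := Module.finrank ℂ (weightSpace n p μ)

/-! ### Semistandard tableaux with entries `1, …, n` and at most `p` rows

Rows, columns and entries are counted from `0`: the entry `i` stands for `i + 1`. -/

/-- The set `𝕐_n(p)` of semistandard Young tableaux with at most `p` rows and `n` admissible
entries. -/
structure Tableau (n p : ℕ) where
  shape : YoungDiagram
  entry : SemistandardYoungTableau shape
  entry_lt : ∀ {r c : ℕ}, (r, c) ∈ shape → entry r c < n
  length_le : shape.colLen 0 ≤ p

namespace Tableau

variable {n p : ℕ}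

/-- The weight `μ_A`: `(μ_A)_i` is the number of entries `i` in `A`. -/
def weight (A : Tableau n p) (i : Fin n) : ℕ :=
  (A.shape.cells.filter fun c => A.entry c.1 c.2 = i).card

/-- The shape `λ_{A^k}` of the `k`-th subtableau, formed by the boxes of `A` that contain one of
the `k` smallest admissible entries. -/
def subshape (A : Tableau n p) (k : ℕ) : YoungDiagram where
  cells := A.shape.cells.filter fun c => A.entry c.1 c.2 < k
  isLowerSet := by
    rintro ⟨r, c⟩ ⟨r', c'⟩ hle h
    obtain ⟨hr, hc⟩ := Prod.mk_le_mk.mp hle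
    simp only [Finset.coe_filter, Set.mem_ofPred_eq, YoungDiagram.mem_cells] at h ⊢
    have hmem : (r', c) ∈ A.shape := A.shape.up_left_mem hr le_rfl h.1
    exact ⟨A.shape.up_left_mem hr hc h.1,
      lt_of_le_of_lt ((A.entry.row_weak_of_le hc hmem).trans (A.entry.col_weak hr h.1)) h.2⟩

/-- The factorial `λ_A! = λ'_1! λ'_2! ⋯`, the product running over the columns. -/
def shapeFactorial (A : Tableau n p) : ℕ :=
  ∏ c ∈ Finset.range (A.shape.rowLen 0), (A.shape.colLen c).factorial

/-- The `c`-th column of `A`, read downwards. -/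
def column (A : Tableau n p) (c : ℕ) (r : Fin (A.shape.colLen c)) : Fin n :=
  ⟨A.entry r c, A.entry_lt (YoungDiagram.mem_iff_lt_colLen.mpr r.isLt)⟩

end Tableau

/-- Graded lexicographic order on `ℕ^n`. -/
def weightLT {n : ℕ} (μ ν : Fin n → ℕ) : Prop :=
  ∑ i, μ i < ∑ i, ν i ∨
    (∑ i, μ i = ∑ i, ν i ∧ ∃ j, (∀ i < j, μ i = ν i) ∧ μ j < ν j)

/-- Graded lexicographic order on partitions. -/
def partitionLT (κ ν : YoungDiagram) : Prop :=
  κ.card < ν.card ∨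
    (κ.card = ν.card ∧ ∃ j, (∀ i < j, κ.rowLen i = ν.rowLen i) ∧ κ.rowLen j < ν.rowLen j)

/-- The order on tableaux: first compare the weights, then the shapes of the subtableaux. -/
instance (n p : ℕ) : LT (Tableau n p) where
  lt A B := weightLT A.weight B.weight ∨
    (A.weight = B.weight ∧ ∃ k ∈ Finset.Icc 1 n,
      (∀ l ∈ Finset.Icc 1 n, l < k → A.subshape l = B.subshape l) ∧
        partitionLT (A.subshape k) (B.subshape k))

/-! ### Tableau vectors and leading terms -/

/-- The operator `X_I = ∑_{σ ∈ S_k} sgn(σ) X_{i_{σ(1)}} ⋯ X_{i_{σ(k)}}`. -/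
def columnOp {n p k : ℕ} (I : Fin k → Fin n) : Module.End ℂ (CliffPoly n p) :=
  ∑ σ : Equiv.Perm (Fin k),
    ((Equiv.Perm.sign σ : ℤ) : ℂ) • (List.ofFn fun r : Fin k => X (I (σ r))).prod

namespace Tableau

variable {n p : ℕ}

/-- `ω_A(p) = X_{a_m} ⋯ X_{a_1}(1)`, where `a_1, …, a_m` are the columns of `A` from left to
right. -/
def omega (A : Tableau n p) : CliffPoly n p :=
  (List.range (A.shape.rowLen 0)).foldl (fun v c => columnOp (A.column c) v) (vac n p)

/-- The normalized tableau vector `ω̃_A(p) = ω_A(p) / λ_A!`. -/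
def omegaTilde (A : Tableau n p) : CliffPoly n p :=
  ((A.shapeFactorial : ℂ))⁻¹ • A.omega

/-- For a filling `C` of the shape of `A` by `1, …, p`: the monomial
`x_{A,C} = ∏_{(k,l)} x_{a_{k,l}, c_{k,l}}`. -/
def xMonomial (A : Tableau n p) (C : A.shape.cells → Fin p) : MvPolynomial (Fin n × Fin p) ℂ :=
  ∏ b : A.shape.cells,
    MvPolynomial.X (⟨A.entry b.1.1 b.1.2, A.entry_lt ((YoungDiagram.mem_cells _).mp b.2)⟩, C b)

/-- For a filling `C` of the shape of `A` by `1, …, p`: the Clifford monomial `e_C`, the product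
of the `e_{c_{k,l}}`, the columns being taken from right to left and each being read downwards. -/
def eMonomial (A : Tableau n p) (C : A.shape.cells → Fin p) : Cl p :=
  (List.ofFn fun c : Fin (A.shape.rowLen 0) =>
    (List.ofFn fun r : Fin (A.shape.colLen c) =>
      e (C ⟨(r, c), (YoungDiagram.mem_cells _).mpr
        (YoungDiagram.mem_iff_lt_colLen.mpr r.isLt)⟩)).prod).reverse.prod

/-- The filling `D_A` all of whose entries in the `k`-th row are `k`. -/
def rowFilling (A : Tableau n p) (b : A.shape.cells) : Fin p :=
  ⟨b.1.1, lt_of_lt_of_le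
    (lt_of_lt_of_le (YoungDiagram.mem_iff_lt_colLen.mp ((YoungDiagram.mem_cells _).mp b.2))
      (A.shape.colLen_anti 0 b.1.2 (Nat.zero_le _))) A.length_le⟩

/-- The leading term `x_{A,D_A} e_{D_A}` of `ω̃_A(p)`. -/
def leadingTerm (A : Tableau n p) : CliffPoly n p :=
  A.xMonomial A.rowFilling ⊗ₜ[ℂ] A.eMonomial A.rowFilling

end Tableau

/-- `A_1 < ⋯ < A_d` are precisely the tableaux of weight `μ` in `𝕐_n(p)`. -/
def IsEnumeration {n p d : ℕ} (μ : Fin n → ℕ) (A : Fin d → Tableau n p) : Prop :=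
  (∀ k l : Fin d, k < l → A k < A l) ∧ Set.range A = {T | T.weight = μ}

/-- The matrix `U_μ`: its `(k,l)` entry is the coefficient of the leading term of `ω̃_{A_k}(p)` in
`ω̃_{A_l}(p)`. -/
def transitionMatrix {n p d : ℕ} (A : Fin d → Tableau n p) : Matrix (Fin d) (Fin d) ℂ :=
  Matrix.of fun k l => pairing (A k).leadingTerm (A l).omegaTilde

/-- The vector `f_μ(v)` of the coefficients in `v` of the leading terms. -/
def leadingCoeffs {n p d : ℕ} (A : Fin d → Tableau n p) (v : CliffPoly n p) : Fin d → ℂ :=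
  fun k => pairing (A k).leadingTerm v

open Classical in
/-- The chains `k = l_0 < l_1 < ⋯ < l_t` in an index set of size `d`. -/
def chains {d : ℕ} (k : Fin d) (t : ℕ) : Finset (Fin (t + 1) → Fin d) :=
  Finset.univ.filter fun l => l 0 = k ∧ StrictMono l

end

end Paraboson

/-! The vectors `omegaTilde` are triangular with respect to their leading monomials, and every
nonzero vector of `L n p` contains at least one such monomial. These two facts give everything.

Triangularity. Compare monomials by `cornerSum`, the degree of x^γ in the variables x_{i,α} with i <
k and α < r. Since the e_α anticommute, X_I / k! is the sum of ± monomial operators over injective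
fillings of the column (`columnOp_eq`), and the filling by row numbers has the strictly largest
corner sums. Hence ω̃_A is its leading term plus an integer combination of monomials with strictly
smaller corner sums (`omegaTilde_sub_leadingTerm_mem`). The corner sums of a leading term are
partial sums of row lengths of the subtableaux (`cornerSum_exponent`), so the order on tableaux of a
given weight refines dominance. Thus U_μ is integral and unitriangular.

Completeness (`eq_zero_of_pairing_leadingTerm`). A weight vector whose leading coefficients all
vanish is zero; neither a character formula nor straightening is needed. The operators X_i and D_i
commute with the simultaneous infinitesimal rotations of the variables and of the e_α, which kill 1
and therefore all of `L n p`. In a nonzero v take the monomial that is lexicographically largest,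
first by column degrees and then row by row. For adjacent columns α, β, collect the coefficients of
the monomials obtained by exchanging factors x_{i,α} and x_{i,β} into a polynomial q in n variables.
By maximality the rotation relation reduces to ∑ ∂_i q = 0, so q is translation invariant, and
`sum_exponents_le`, applied to its lexicographically smallest monomial, gives the inequalities of a
lattice word (`exists_lattice_monomial`). They say exactly that γ is the exponent of a semistandard
tableau (`exists_exponent_eq`). The Clifford factor is determined by γ through parities
(`L_le_parity`), so a leading coefficient of v is nonzero.

Consequently the leading coefficients identify the weight space with ℂ^d, d being the number of
tableaux, and inverting U_μ gives the expansion. Since X_i and D_i preserve integer coordinates and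
the inverse of U_μ is integral, the matrix elements are integers. -/

namespace PolynomialShift

noncomputable section

/-! ### Translations of polynomials -/

section

open Polynomial

variable {W : Type*} [CommRing W]

/-- The extension of `τ : W → W[t]` to `W[y] → W[y][t]` by `y ↦ y + t`. -/
def extendShift (τ : W →+* W[X]) : W[X] →+* W[X][X] :=
  eval₂RingHom ((mapRingHom C).comp τ) (C X + X)

theorem extendShift_C (τ : W →+* W[X]) (w : W) : extendShift τ (C w) = (τ w).map C := by
  simp [extendShift]

theorem extendShift_X (τ : W →+* W[X]) : extendShift τ X = C X + X := by
  simp [extendShift]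

theorem eval_zero_extendShift {τ : W →+* W[X]} (hτ : ∀ w, (τ w).eval 0 = w) (P : W[X]) :
    (extendShift τ P).eval 0 = P := by
  have : (evalRingHom (0 : W[X])).comp (extendShift τ) = RingHom.id _ := by
    refine Polynomial.ringHom_ext (fun w => ?_) ?_
    · simp only [RingHom.comp_apply, extendShift_C, coe_evalRingHom, RingHom.id_apply]
      have h := Polynomial.eval_map_apply (C : W →+* W[X]) (p := τ w) 0
      rw [map_zero] at h
      rw [h, hτ]
    · simp [extendShift_X]
  exact DFunLike.congr_fun this P

theorem natDegree_coeff_extendShift_le (τ : W →+* W[X]) {P : W[X]} {d : ℕ}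
    (hd : P.natDegree ≤ d) (i : ℕ) : ((extendShift τ P).coeff i).natDegree ≤ d := by
  rw [P.as_sum_range' (d + 1) (Nat.lt_succ_of_le hd), map_sum, finsetSum_coeff]
  refine natDegree_sum_le_of_forall_le _ _ fun b hb => ?_
  rw [← C_mul_X_pow_eq_monomial, map_mul, map_pow, extendShift_C, extendShift_X, add_comm (C X),
    coeff_mul]
  refine natDegree_sum_le_of_forall_le _ _ fun x _ => ?_
  rw [coeff_map, coeff_X_add_C_pow, ← C_eq_natCast, mul_comm _ (C _)]
  refine (natDegree_C_mul_le _ _).trans ((natDegree_C_mul_le _ _).trans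
    ((natDegree_X_pow_le _).trans ?_))
  have := Finset.mem_range.mp hb
  omega

/-- The substitution `y ↦ -t` in `W[y][t]`. -/
def substNeg : W[X][X] →+* W[X] :=
  eval₂RingHom (eval₂RingHom C (-X)) X

/-- At y = -t the image y + t of y vanishes, so only the constant coefficient survives. -/
theorem substNeg_extendShift (τ : W →+* W[X]) (P : W[X]) :
    substNeg (extendShift τ P) = τ (P.coeff 0) := by
  have : substNeg.comp (extendShift τ) = τ.comp constantCoeff := by
    refine Polynomial.ringHom_ext (fun w => ?_) ?_
    · simp only [RingHom.comp_apply, extendShift_C, substNeg, coe_eval₂RingHom, eval₂_map,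
        constantCoeff_apply, coeff_C_zero]
      have : (eval₂RingHom C (-X) : W[X] →+* W[X]).comp C = C := by ext; simp
      rw [this, eval₂_C_X]
    · simp [extendShift_X, substNeg]
  exact DFunLike.congr_fun this P

theorem natDegree_substNeg_le {Z : W[X][X]} {d s : ℕ} (hs : Z.natDegree ≤ s)
    (hd : ∀ i, (Z.coeff i).natDegree ≤ d) : (substNeg Z).natDegree ≤ s + d := by
  rw [substNeg, coe_eval₂RingHom, eval₂_eq_sum_range]
  refine natDegree_sum_le_of_forall_le _ _ fun i hi => ?_
  refine natDegree_mul_le.trans ?_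
  have h1 : (eval₂RingHom C (-X) (Z.coeff i) : W[X]).natDegree ≤ d := by
    rw [coe_eval₂RingHom, eval₂_eq_sum_range]
    refine natDegree_sum_le_of_forall_le _ _ fun k hk => ?_
    refine (natDegree_C_mul_le _ _).trans ?_
    refine natDegree_pow_le.trans ?_
    have h2 : (-X : W[X]).natDegree ≤ 1 := by rw [natDegree_neg]; exact natDegree_X_le
    have := Finset.mem_range.mp hk
    have := hd i
    nlinarith
  have h3 := natDegree_X_pow_le (R := W) i
  have := Finset.mem_range.mp hi
  omega

/-- Write P = y^j h with h(0) ≠ 0. The translate of P is (y + t)^j times that of h, so the translate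
of h has degree at most s - j in t and at most d - j in y. Putting y = -t turns it into the
translate of h(0), whose degree is then at most (s - j) + (d - j). -/
theorem natDegree_shift_coeff_le [IsDomain W] {τ : W →+* W[X]} (hτ : ∀ w, (τ w).eval 0 = w)
    {P : W[X]} {j d s : ℕ} (hd : P.natDegree ≤ d) (hj : ∀ i < j, P.coeff i = 0)
    (hne : P.coeff j ≠ 0) (hs : (extendShift τ P).natDegree ≤ s) :
    j ≤ s ∧ (τ (P.coeff j)).natDegree + 2 * j ≤ s + d := by
  obtain ⟨h, rfl⟩ := X_pow_dvd_iff.mpr hj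
  have h0 : (X ^ j * h).coeff j = h.coeff 0 := by simp [coeff_X_pow_mul']
  rw [h0] at hne ⊢
  have hh : h ≠ 0 := by rintro rfl; simp at hne
  have hl : extendShift τ h ≠ 0 := by
    intro h1
    apply hh
    rw [← eval_zero_extendShift hτ h, h1, eval_zero]
  have hdeg : (X ^ j * h).natDegree = j + h.natDegree := by
    rw [natDegree_mul (pow_ne_zero _ X_ne_zero) hh, natDegree_X_pow]
  have hshift : (extendShift τ (X ^ j * h)).natDegree = j + (extendShift τ h).natDegree := by
    have : (C X + X : W[X][X]) = X + C X := add_comm _ _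
    rw [map_mul, map_pow, extendShift_X, this, natDegree_mul (pow_ne_zero _ (X_add_C_ne_zero _)) hl,
      natDegree_pow, natDegree_X_add_C, mul_one]
  have key := natDegree_substNeg_le (Z := extendShift τ h) (s := s - j) (d := d - j) (by omega)
    (fun i => natDegree_coeff_extendShift_le τ (by omega) i)
  rw [substNeg_extendShift] at key
  omega

/-- The simultaneous translation `y_i ↦ y_i + t`. -/
def shift (R : Type*) [CommRing R] (n : ℕ) :
    MvPolynomial (Fin n) R →+* (MvPolynomial (Fin n) R)[X] :=
  MvPolynomial.eval₂Hom (C.comp MvPolynomial.C) fun i => C (MvPolynomial.X i) + X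

variable {R : Type*} [CommRing R]

theorem eval_zero_shift {n : ℕ} (v : MvPolynomial (Fin n) R) : (shift R n v).eval 0 = v := by
  have : (evalRingHom (0 : MvPolynomial (Fin n) R)).comp (shift R n) = RingHom.id _ := by
    refine MvPolynomial.ringHom_ext (fun w => ?_) fun i => ?_ <;> simp [shift]
  exact DFunLike.congr_fun this v

/-- Separating the variable y_0 makes translation in n + 1 variables a one-variable extension of
translation in n variables, as the induction below requires. -/
theorem extendShift_finSuccEquiv {n : ℕ} (v : MvPolynomial (Fin (n + 1)) R) :
    extendShift (shift R n) (MvPolynomial.finSuccEquiv R n v)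
      = (shift R (n + 1) v).map (MvPolynomial.finSuccEquiv R n : _ →+* _) := by
  have : (extendShift (shift R n)).comp (MvPolynomial.finSuccEquiv R n : _ →+* _)
      = (mapRingHom (MvPolynomial.finSuccEquiv R n : _ →+* _)).comp (shift R (n + 1)) := by
    refine MvPolynomial.ringHom_ext (fun w => ?_) fun i => ?_
    · simp [shift, MvPolynomial.finSuccEquiv_apply, extendShift_C]
    · refine Fin.cases ?_ (fun i => ?_) i
      · simp [shift, MvPolynomial.finSuccEquiv_X_zero, extendShift_X]
      · simp [shift, MvPolynomial.finSuccEquiv_X_succ, extendShift_C]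
  exact DFunLike.congr_fun this v

/-- The exponents of the lexicographically smallest monomial of a polynomial whose translates
have bounded degree in the translation parameter. -/
theorem sum_exponents_le [IsDomain R] {n : ℕ} (s : ℕ) (d : Fin n → ℕ) (v : MvPolynomial (Fin n) R)
    (hs : (shift R n v).natDegree ≤ s) (hd : ∀ b ∈ v.support, ∀ i, b i ≤ d i)
    (b : Fin n →₀ ℕ) (hb : b ∈ v.support)
    (hmin : ∀ c ∈ v.support, ∀ k, (∀ i < k, c i = b i) → b k ≤ c k) (k : Fin n) :
    ∑ i ∈ Finset.Iic k, b i ≤ s + ∑ i ∈ Finset.Iio k, (d i - b i) := by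
  induction n generalizing s with
  | zero => exact k.elim0
  | succ n ih =>
    set P := MvPolynomial.finSuccEquiv R n v with hP
    have hcoeff : ∀ (m : Fin n →₀ ℕ) (i : ℕ), (P.coeff i).coeff m = v.coeff (m.cons i) :=
      fun m i => MvPolynomial.finSuccEquiv_coeff_coeff m v i
    have hcons : b.tail.cons (b 0) = b := Finsupp.cons_tail b
    have hbt : b.tail ∈ (P.coeff (b 0)).support := by
      rw [MvPolynomial.mem_support_iff, hcoeff, hcons]
      exact MvPolynomial.mem_support_iff.mp hb
    have hdeg : P.natDegree ≤ d 0 := by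
      rw [Polynomial.natDegree_le_iff_coeff_eq_zero]
      intro N hN
      ext m
      rw [hcoeff, MvPolynomial.coeff_zero]
      by_contra h
      have := hd _ (MvPolynomial.mem_support_iff.mpr h) 0
      rw [Finsupp.cons_zero] at this
      omega
    have hlow : ∀ i < b 0, P.coeff i = 0 := by
      intro i hi
      ext m
      rw [hcoeff, MvPolynomial.coeff_zero]
      by_contra h
      have := hmin _ (MvPolynomial.mem_support_iff.mpr h) 0 (fun i hi => absurd hi (by simp))
      rw [Finsupp.cons_zero] at this
      omega
    have hne : P.coeff (b 0) ≠ 0 := by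
      intro h
      rw [h] at hbt
      simp at hbt
    have hsP : (extendShift (shift R n) P).natDegree ≤ s := by
      rw [hP, extendShift_finSuccEquiv]
      exact natDegree_map_le.trans hs
    obtain ⟨h1, h2⟩ := natDegree_shift_coeff_le eval_zero_shift hdeg hlow hne hsP
    have hb0 := hd b hb 0
    -- Passing to the coefficient of y_0^{b_0} replaces the bound s by s + d_0 - 2 b_0. The
    -- subtraction does not truncate, because b_0 ≤ s and b_0 ≤ d_0.
    have IH := ih (s + d 0 - 2 * b 0) (fun i => d i.succ) (P.coeff (b 0)) (by omega)
      (fun c hc i => by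
        have := hd (c.cons (b 0)) (by
          rw [MvPolynomial.mem_support_iff, ← hcoeff]
          exact MvPolynomial.mem_support_iff.mp hc) i.succ
        rwa [Finsupp.cons_succ] at this)
      b.tail hbt
      (fun c hc k hk => by
        have := hmin (c.cons (b 0)) (by
          rw [MvPolynomial.mem_support_iff, ← hcoeff]
          exact MvPolynomial.mem_support_iff.mp hc) k.succ (fun i hi => by
            induction i using Fin.cases with
            | zero => rw [Finsupp.cons_zero]
            | succ i =>
              rw [Finsupp.cons_succ, hk i (Fin.succ_lt_succ_iff.mp hi), Finsupp.tail_apply])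
        rwa [Finsupp.cons_succ] at this)
    have hIic : ∀ (f : Fin (n + 1) → ℕ) (k : Fin n),
        ∑ i ∈ Finset.Iic k.succ, f i = f 0 + ∑ i ∈ Finset.Iic k, f i.succ := by
      intro f k
      rw [← Finset.filter_ge_eq_Iic, Finset.sum_filter, Fin.sum_univ_succ,
        ← Finset.filter_ge_eq_Iic, Finset.sum_filter]
      simp
    have hIio : ∀ (f : Fin (n + 1) → ℕ) (k : Fin n),
        ∑ i ∈ Finset.Iio k.succ, f i = f 0 + ∑ i ∈ Finset.Iio k, f i.succ := by
      intro f k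
      rw [← Finset.filter_gt_eq_Iio, Finset.sum_filter, Fin.sum_univ_succ,
        ← Finset.filter_gt_eq_Iio, Finset.sum_filter]
      simp
    induction k using Fin.cases with
    | zero =>
      have : Finset.Iic (0 : Fin (n + 1)) = {0} := by
        ext i; simp
      rw [this, Finset.sum_singleton]
      omega
    | succ k =>
      rw [hIic, hIio]
      have := IH k
      simp only [Finsupp.tail_apply] at this
      omega

/-- The t-derivative of v(y + t) is the translate of ∑ ∂_i v; in characteristic zero its vanishing
makes v(y + t) constant in t. -/
theorem natDegree_shift_eq_zero [IsDomain R] [CharZero R] {n : ℕ} {v : MvPolynomial (Fin n) R}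
    (hv : ∑ i, MvPolynomial.pderiv i v = 0) : (shift R n v).natDegree = 0 := by
  have key : ∀ v, derivative (shift R n v) = shift R n (∑ i, MvPolynomial.pderiv i v) := by
    intro v
    induction v using MvPolynomial.induction_on with
    | C a => simp [shift]
    | add p q hp hq => simp only [map_add, hp, hq, Finset.sum_add_distrib]
    | mul_X p i hp =>
      have h1 : ∑ j, MvPolynomial.pderiv j (p * MvPolynomial.X i)
          = (∑ j, MvPolynomial.pderiv j p) * MvPolynomial.X i + p := by
        simp only [Derivation.leibniz, MvPolynomial.pderiv_X, Finset.sum_add_distrib, smul_eq_mul]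
        rw [add_comm, ← Finset.mul_sum, mul_comm]
        congr 1
        rw [← Finset.mul_sum]
        simp [Pi.single_apply]
      rw [h1, map_mul, derivative_mul, hp, map_add, map_mul]
      congr 1
      simp [shift]
  refine derivative_eq_zero.mp ?_
  rw [key, hv, map_zero]

end

end

end PolynomialShift

namespace Paraboson

noncomputable section

/-! ### Coordinates with respect to the monomial basis -/

section Coordinates

variable {n p : ℕ}

/-- The index set of the monomials `x^γ e^η`. -/
abbrev MonomialIndex (n p : ℕ) : Type := (Fin n × Fin p →₀ ℕ) × (Fin p → ZMod 2)

theorem cliffordBasis_repr_apply (u : Cl p) (η : Fin p → ZMod 2) :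
    (cliffordBasis p).repr u η = cliffordCoord p u η := by
  have : (Finsupp.lcoeFun.comp (cliffordBasis p).repr.toLinearMap : Cl p →ₗ[ℂ] _)
      = cliffordCoord p := by
    refine (cliffordBasis p).ext fun ζ => ?_
    rw [cliffordBasis_apply, cliffordCoord_monomial, ← cliffordBasis_apply]
    ext ξ
    simp [Finsupp.single_apply, Pi.single_apply, eq_comm]
  exact congrFun (DFunLike.congr_fun this u) η

theorem cliffordBasis_repr_e_mul (α : Fin p) (u : Cl p) (η : Fin p → ZMod 2) :
    (cliffordBasis p).repr (e α * u) η
      = (∏ β : Fin p, if β < α then (-1 : ℂ) ^ (η β).val else 1)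
        * (cliffordBasis p).repr u (η + Pi.single α 1) := by
  rw [cliffordBasis_repr_apply, cliffordBasis_repr_apply, ← coordMul_apply]
  have : cliffordCoord p (e α * u) = coordMul α (cliffordCoord p u) := by
    simp [cliffordCoord, e, coordLin]
  rw [this]

theorem prod_sign_eq (α : Fin p) (η : Fin p → ZMod 2) :
    ∃ z : ℤˣ, (∏ β : Fin p, if β < α then (-1 : ℂ) ^ (η β).val else 1) = ((z : ℤ) : ℂ) := by
  refine ⟨∏ β : Fin p, if β < α then (-1) ^ (η β).val else 1, ?_⟩
  push_cast
  refine Finset.prod_congr rfl fun β _ => ?_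
  split_ifs <;> simp

theorem e_mul_cliffordBasis (α : Fin p) (η : Fin p → ZMod 2) :
    ∃ z : ℤˣ, e α * cliffordBasis p η
      = ((z : ℤ) : ℂ) • cliffordBasis p (η + Pi.single α 1) := by
  obtain ⟨z, hz⟩ := prod_sign_eq α (η + Pi.single α 1)
  refine ⟨z, (cliffordBasis p).ext_elem fun ζ => ?_⟩
  rw [cliffordBasis_repr_e_mul, map_smul, Module.Basis.repr_self, Module.Basis.repr_self,
    Finsupp.smul_apply, smul_eq_mul, Finsupp.single_apply, Finsupp.single_apply]
  by_cases h : η + Pi.single α 1 = ζ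
  · subst h
    rw [shift_shift, hz]
    simp
  · have h' : ¬ η = ζ + Pi.single α 1 := by
      rintro rfl
      exact h (shift_shift α ζ)
    simp [h, h']

theorem monomialBasis_eq (b : MonomialIndex n p) :
    monomialBasis n p b = MvPolynomial.monomial b.1 1 ⊗ₜ[ℂ] cliffordBasis p b.2 := by
  rw [monomialBasis, Module.Basis.tensorProduct_apply', MvPolynomial.coe_basisMonomials]

theorem monomialBasis_repr_tmul (f : MvPolynomial (Fin n × Fin p) ℂ) (u : Cl p)
    (γ : Fin n × Fin p →₀ ℕ) (η : Fin p → ZMod 2) :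
    (monomialBasis n p).repr (f ⊗ₜ u) (γ, η) = f.coeff γ * (cliffordBasis p).repr u η := by
  rw [monomialBasis, Module.Basis.tensorProduct_repr_tmul_apply, smul_eq_mul, mul_comm]
  rfl

/-- The span of the monomials with index in `S`. -/
def supportedOn (S : Set (MonomialIndex n p)) : Submodule ℂ (CliffPoly n p) :=
  (Finsupp.supported ℂ ℂ S).comap (monomialBasis n p).repr.toLinearMap

theorem mem_supportedOn {S : Set (MonomialIndex n p)} {v : CliffPoly n p} :
    v ∈ supportedOn S ↔ ∀ b, (monomialBasis n p).repr v b ≠ 0 → b ∈ S := by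
  rw [supportedOn, Submodule.mem_comap, Finsupp.mem_supported]
  exact ⟨fun h b hb => h (Finsupp.mem_support_iff.mpr hb),
    fun h b hb => h b (Finsupp.mem_support_iff.mp hb)⟩

theorem supportedOn_mono {S S' : Set (MonomialIndex n p)} (h : S ⊆ S') :
    (supportedOn S : Submodule ℂ (CliffPoly n p)) ≤ supportedOn S' :=
  fun _ hv => mem_supportedOn.mpr fun b hb => h (mem_supportedOn.mp hv b hb)

theorem eq_sum_monomialBasis (v : CliffPoly n p) :
    v = ∑ b ∈ ((monomialBasis n p).repr v).support,
      (monomialBasis n p).repr v b • monomialBasis n p b := by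
  conv_lhs => rw [← (monomialBasis n p).linearCombination_repr v, Finsupp.linearCombination_apply,
    Finsupp.sum]

theorem map_mem_supportedOn {S S' : Set (MonomialIndex n p)} (Φ : Module.End ℂ (CliffPoly n p))
    (h : ∀ b ∈ S, Φ (monomialBasis n p b) ∈ supportedOn S') {v : CliffPoly n p}
    (hv : v ∈ supportedOn S) : Φ v ∈ supportedOn S' := by
  rw [eq_sum_monomialBasis v, map_sum]
  refine Submodule.sum_mem _ fun b hb => ?_
  rw [map_smul]
  exact Submodule.smul_mem _ _ (h b (mem_supportedOn.mp hv b (Finsupp.mem_support_iff.mp hb)))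

theorem tmul_mem_supportedOn {S : Set (MonomialIndex n p)} {γ : Fin n × Fin p →₀ ℕ} (a : ℂ)
    (u : Cl p) (h : ∀ η, (γ, η) ∈ S) : MvPolynomial.monomial γ a ⊗ₜ u ∈ supportedOn S := by
  rw [mem_supportedOn]
  rintro ⟨γ', η⟩ hb
  rw [monomialBasis_repr_tmul, MvPolynomial.coeff_monomial] at hb
  by_cases h' : γ = γ'
  · subst h'; exact h η
  · simp [h'] at hb

theorem monomialBasis_mem_supportedOn {S : Set (MonomialIndex n p)} {b : MonomialIndex n p}
    (h : b ∈ S) : monomialBasis n p b ∈ supportedOn S := by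
  rw [mem_supportedOn]
  intro b' hb'
  rw [Module.Basis.repr_self, Finsupp.single_apply] at hb'
  split_ifs at hb' with h'
  · exact h' ▸ h
  · exact absurd rfl hb'

/-- The vectors with integer coordinates. -/
def integralVectors (n p : ℕ) : AddSubgroup (CliffPoly n p) where
  carrier := {v | ∀ b, ∃ z : ℤ, (monomialBasis n p).repr v b = z}
  zero_mem' b := ⟨0, by simp⟩
  add_mem' {v w} hv hw b := by
    obtain ⟨z, hz⟩ := hv b
    obtain ⟨z', hz'⟩ := hw b
    exact ⟨z + z', by simp [hz, hz']⟩
  neg_mem' {v} hv b := by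
    obtain ⟨z, hz⟩ := hv b
    exact ⟨-z, by simp [hz]⟩

theorem intCast_smul_mem_integralVectors (z : ℤ) {v : CliffPoly n p}
    (hv : v ∈ integralVectors n p) : (z : ℂ) • v ∈ integralVectors n p := by
  rw [Int.cast_smul_eq_zsmul ℂ z v]
  exact AddSubgroup.zsmul_mem _ hv z

theorem monomialBasis_mem_integralVectors (b : MonomialIndex n p) :
    monomialBasis n p b ∈ integralVectors n p := by
  classical
  intro b'
  rw [Module.Basis.repr_self, Finsupp.single_apply]
  split_ifs
  · exact ⟨1, by simp⟩
  · exact ⟨0, by simp⟩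

theorem map_mem_integralVectors (Φ : Module.End ℂ (CliffPoly n p))
    (h : ∀ b, Φ (monomialBasis n p b) ∈ integralVectors n p) {v : CliffPoly n p}
    (hv : v ∈ integralVectors n p) : Φ v ∈ integralVectors n p := by
  rw [eq_sum_monomialBasis v, map_sum]
  refine AddSubgroup.sum_mem _ fun b _ => ?_
  obtain ⟨z, hz⟩ := hv b
  rw [map_smul, hz]
  exact intCast_smul_mem_integralVectors z (h b)

end Coordinates

/-! ### The generators on monomials -/

section Generators

variable {n p : ℕ}

/-- Multiplication by `x_{i,α} e_α`. -/
def mulXE (i : Fin n) (α : Fin p) : Module.End ℂ (CliffPoly n p) :=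
  TensorProduct.map
    (LinearMap.mulLeft ℂ (MvPolynomial.X (i, α) : MvPolynomial (Fin n × Fin p) ℂ))
    (LinearMap.mulLeft ℂ (e α))

/-- The operator `∂_{i,α} e_α`. -/
def pderivE (i : Fin n) (α : Fin p) : Module.End ℂ (CliffPoly n p) :=
  TensorProduct.map
    ((MvPolynomial.pderiv (i, α) :
      Derivation ℂ (MvPolynomial (Fin n × Fin p) ℂ) (MvPolynomial (Fin n × Fin p) ℂ)) :
        MvPolynomial (Fin n × Fin p) ℂ →ₗ[ℂ] MvPolynomial (Fin n × Fin p) ℂ)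
    (LinearMap.mulLeft ℂ (e α))

theorem X_eq_sum (i : Fin n) : (X i : Module.End ℂ (CliffPoly n p)) = ∑ α, mulXE i α := rfl

theorem D_eq_sum (i : Fin n) : (D i : Module.End ℂ (CliffPoly n p)) = ∑ α, pderivE i α := rfl

theorem mulXE_monomialBasis (i : Fin n) (α : Fin p) (b : MonomialIndex n p) :
    ∃ z : ℤˣ, mulXE i α (monomialBasis n p b)
      = ((z : ℤ) : ℂ) • monomialBasis n p
          (b.1 + Finsupp.single (i, α) 1, b.2 + Pi.single α 1) := by
  obtain ⟨z, hz⟩ := e_mul_cliffordBasis α b.2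
  refine ⟨z, ?_⟩
  rw [monomialBasis_eq, monomialBasis_eq, mulXE, TensorProduct.map_tmul, LinearMap.mulLeft_apply,
    LinearMap.mulLeft_apply, hz, TensorProduct.tmul_smul, MvPolynomial.X,
    MvPolynomial.monomial_mul, one_mul, add_comm]

theorem pderivE_monomialBasis (i : Fin n) (α : Fin p) (b : MonomialIndex n p) :
    ∃ z : ℤˣ, pderivE i α (monomialBasis n p b)
      = ((z * b.1 (i, α) : ℤ) : ℂ) • monomialBasis n p
          (b.1 - Finsupp.single (i, α) 1, b.2 + Pi.single α 1) := by
  obtain ⟨z, hz⟩ := e_mul_cliffordBasis α b.2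
  refine ⟨z, ?_⟩
  rw [monomialBasis_eq, monomialBasis_eq, pderivE, TensorProduct.map_tmul, LinearMap.mulLeft_apply,
    hz, TensorProduct.tmul_smul, Derivation.coeFn_coe, MvPolynomial.pderiv_monomial, one_mul,
    ← mul_one ((b.1 (i, α) : ℕ) : ℂ), ← smul_eq_mul, ← MvPolynomial.smul_monomial,
    TensorProduct.smul_tmul', smul_smul]
  push_cast
  rfl

theorem X_mem_integralVectors (i : Fin n) {v : CliffPoly n p} (hv : v ∈ integralVectors n p) :
    X i v ∈ integralVectors n p := by
  refine map_mem_integralVectors _ (fun b => ?_) hv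
  rw [X_eq_sum, LinearMap.sum_apply]
  refine AddSubgroup.sum_mem _ fun α _ => ?_
  obtain ⟨z, hz⟩ := mulXE_monomialBasis i α b
  rw [hz]
  exact intCast_smul_mem_integralVectors _ (monomialBasis_mem_integralVectors _)

theorem D_mem_integralVectors (i : Fin n) {v : CliffPoly n p} (hv : v ∈ integralVectors n p) :
    D i v ∈ integralVectors n p := by
  refine map_mem_integralVectors _ (fun b => ?_) hv
  rw [D_eq_sum, LinearMap.sum_apply]
  refine AddSubgroup.sum_mem _ fun α _ => ?_
  obtain ⟨z, hz⟩ := pderivE_monomialBasis i α b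
  rw [hz]
  exact intCast_smul_mem_integralVectors _ (monomialBasis_mem_integralVectors _)

theorem X_mem_supportedOn {S S' : Set (MonomialIndex n p)} (i : Fin n)
    (h : ∀ b ∈ S, ∀ α, (b.1 + Finsupp.single (i, α) 1, b.2 + Pi.single α 1) ∈ S')
    {v : CliffPoly n p} (hv : v ∈ supportedOn S) : X i v ∈ supportedOn S' := by
  refine map_mem_supportedOn _ (fun b hb => ?_) hv
  rw [X_eq_sum, LinearMap.sum_apply]
  refine Submodule.sum_mem _ fun α _ => ?_
  obtain ⟨z, hz⟩ := mulXE_monomialBasis i α b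
  rw [hz]
  exact Submodule.smul_mem _ _ (monomialBasis_mem_supportedOn (h b hb α))

theorem D_mem_supportedOn {S S' : Set (MonomialIndex n p)} (i : Fin n)
    (h : ∀ b ∈ S, ∀ α, b.1 (i, α) ≠ 0 →
      (b.1 - Finsupp.single (i, α) 1, b.2 + Pi.single α 1) ∈ S')
    {v : CliffPoly n p} (hv : v ∈ supportedOn S) : D i v ∈ supportedOn S' := by
  refine map_mem_supportedOn _ (fun b hb => ?_) hv
  rw [D_eq_sum, LinearMap.sum_apply]
  refine Submodule.sum_mem _ fun α _ => ?_
  obtain ⟨z, hz⟩ := pderivE_monomialBasis i α b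
  rw [hz]
  by_cases h0 : b.1 (i, α) = 0
  · simp [h0]
  · exact Submodule.smul_mem _ _ (monomialBasis_mem_supportedOn (h b hb α h0))

theorem vac_eq : vac n p = monomialBasis n p (0, 0) := by
  rw [monomialBasis_eq, vac, cliffordBasis_apply, cliffordMonomial]
  simp

/-! ### Weights -/

/-- The degree of `x^γ` in the variables `x_{i,1}, …, x_{i,p}`, for each `i`. -/
def rowDegree (γ : Fin n × Fin p →₀ ℕ) (i : Fin n) : ℕ := ∑ α, γ (i, α)

theorem rowDegree_add (γ δ : Fin n × Fin p →₀ ℕ) :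
    rowDegree (γ + δ) = rowDegree γ + rowDegree δ := by
  funext i
  simp [rowDegree, Finset.sum_add_distrib]

theorem rowDegree_single (i : Fin n) (α : Fin p) :
    rowDegree (Finsupp.single (i, α) 1) = Pi.single i 1 := by
  classical
  funext j
  by_cases h : i = j
  · subst h
    simp [rowDegree, Finsupp.single_apply]
  · simp [rowDegree, Ne.symm h]

theorem e_mul_self (α : Fin p) : (e α : Cl p) * e α = 1 := by
  have h := e_anticomm α α
  rw [if_pos rfl, ← two_mul] at h
  have h2 : (2 : ℂ) • (e α * e α : Cl p) = (2 : ℂ) • 1 := by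
    rw [← Nat.cast_ofNat (R := ℂ), Nat.cast_smul_eq_nsmul, Nat.cast_smul_eq_nsmul, nsmul_eq_mul,
      nsmul_eq_mul, mul_one]
    exact_mod_cast h
  exact smul_right_injective _ (two_ne_zero (α := ℂ)) h2

/-- For α ≠ β multiplication by x_{i,α} commutes with ∂_{i,β} while e_α and e_β anticommute, so the
mixed terms cancel. The diagonal terms give p plus twice the Euler operator of row i, which is why
monomials are weight vectors. -/
theorem X_D_add_D_X_tmul (i : Fin n) (f : MvPolynomial (Fin n × Fin p) ℂ) (u : Cl p) :
    X i (D i (f ⊗ₜ u)) + D i (X i (f ⊗ₜ u))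
      = ((p : ℂ) • f + (2 : ℂ) • ∑ α, MvPolynomial.X (i, α) * MvPolynomial.pderiv (i, α) f)
        ⊗ₜ[ℂ] u := by
  have h1 : X i (D i (f ⊗ₜ[ℂ] u)) = ∑ α, ∑ β, (MvPolynomial.X (i, α)
      * MvPolynomial.pderiv (i, β) f) ⊗ₜ[ℂ] (e α * (e β * u)) := by
    rw [X, D, LinearMap.sum_apply, LinearMap.sum_apply]
    refine Finset.sum_congr rfl fun α _ => ?_
    rw [map_sum]
    rfl
  have h2 : D i (X i (f ⊗ₜ[ℂ] u)) = ∑ α, ∑ β, MvPolynomial.pderiv (i, β) (MvPolynomial.X (i, α)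
      * f) ⊗ₜ[ℂ] (e β * (e α * u)) := by
    rw [X, D, LinearMap.sum_apply, LinearMap.sum_apply, Finset.sum_comm]
    refine Finset.sum_congr rfl fun α _ => ?_
    rw [map_sum]
    rfl
  have h3 : ∀ α β : Fin p, (MvPolynomial.X (i, α)
      * MvPolynomial.pderiv (i, β) f) ⊗ₜ[ℂ] (e α * (e β * u))
      + MvPolynomial.pderiv (i, β) (MvPolynomial.X (i, α) * f) ⊗ₜ[ℂ] (e β * (e α * u))
      = if α = β then (f + (2 : ℂ) • (MvPolynomial.X (i, α) * MvPolynomial.pderiv (i, α) f))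
        ⊗ₜ[ℂ] u else 0 := by
    intro α β
    rw [Derivation.leibniz, smul_eq_mul, smul_eq_mul, TensorProduct.add_tmul, ← add_assoc,
      ← TensorProduct.tmul_add, ← mul_assoc, ← mul_assoc, ← add_mul, e_anticomm,
      MvPolynomial.pderiv_X]
    split_ifs with h
    · subst h
      rw [e_mul_self, one_mul, Pi.single_eq_same, mul_one, add_comm, TensorProduct.add_tmul,
        TensorProduct.smul_tmul, two_mul, two_smul]
    · have h' : (i, β) ≠ (i, α) := fun h' => h (Prod.ext_iff.mp h').2.symm
      rw [Pi.single_eq_of_ne h'.symm]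
      simp
  rw [h1, h2, ← Finset.sum_add_distrib]
  simp_rw [← Finset.sum_add_distrib, h3]
  simp only [Finset.sum_ite_eq, Finset.mem_univ, if_true]
  rw [← TensorProduct.sum_tmul, Finset.sum_add_distrib, Finset.smul_sum]
  simp [Nat.cast_smul_eq_nsmul]

theorem cartan_monomialBasis (i : Fin n) (b : MonomialIndex n p) :
    cartan i (monomialBasis n p b)
      = ((rowDegree b.1 i : ℂ) + (p : ℂ) / 2) • monomialBasis n p b := by
  rw [cartan, LinearMap.smul_apply, LinearMap.add_apply, Module.End.mul_apply,
    Module.End.mul_apply, monomialBasis_eq, X_D_add_D_X_tmul, TensorProduct.smul_tmul',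
    TensorProduct.smul_tmul']
  congr 1
  simp only [MvPolynomial.X_mul_pderiv_monomial]
  rw [← Finset.sum_smul, ← Nat.cast_smul_eq_nsmul ℂ, smul_smul, ← add_smul, smul_smul, rowDegree]
  congr 1
  push_cast
  ring

theorem cartan_repr (i : Fin n) (v : CliffPoly n p) (b : MonomialIndex n p) :
    (monomialBasis n p).repr (cartan i v) b
      = ((rowDegree b.1 i : ℂ) + (p : ℂ) / 2) * (monomialBasis n p).repr v b := by
  have : ((monomialBasis n p).coord b).comp (cartan i)
      = ((rowDegree b.1 i : ℂ) + (p : ℂ) / 2) • (monomialBasis n p).coord b := by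
    refine (monomialBasis n p).ext fun b' => ?_
    rw [LinearMap.comp_apply, cartan_monomialBasis, map_smul, LinearMap.smul_apply,
      Module.Basis.coord_apply, Module.Basis.repr_self, Finsupp.single_apply]
    split_ifs with h
    · rw [h]
    · simp
  exact DFunLike.congr_fun this v

theorem mem_weightSpace {μ : Fin n → ℕ} {v : CliffPoly n p} :
    v ∈ weightSpace n p μ ↔ v ∈ L n p ∧ v ∈ supportedOn {b | rowDegree b.1 = μ} := by
  rw [weightSpace, Submodule.mem_inf, Submodule.mem_iInf, mem_supportedOn]
  refine and_congr_right fun _ => ?_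
  simp only [Module.End.mem_eigenspace_iff]
  constructor
  · intro h b hb
    funext i
    have h1 := cartan_repr i v b
    rw [h i, map_smul, Finsupp.smul_apply, smul_eq_mul] at h1
    have h2 := mul_right_cancel₀ hb h1
    exact_mod_cast (add_right_cancel h2).symm
  · intro h i
    refine (monomialBasis n p).ext_elem fun b => ?_
    rw [cartan_repr, map_smul, Finsupp.smul_apply, smul_eq_mul]
    by_cases hb : (monomialBasis n p).repr v b = 0
    · rw [hb, mul_zero, mul_zero]
    · rw [show rowDegree b.1 = μ from h b hb]

/-! ### The module `L_n(p)` -/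

theorem L_le {W : Submodule ℂ (CliffPoly n p)} (h1 : vac n p ∈ W)
    (h2 : ∀ i : Fin n, ∀ w ∈ W, X i w ∈ W ∧ D i w ∈ W) : L n p ≤ W :=
  sInf_le ⟨h1, h2⟩

theorem vac_mem_L : vac n p ∈ L n p := by
  rw [L, Submodule.mem_sInf]
  exact fun W hW => hW.1

theorem X_mem_L (i : Fin n) {v : CliffPoly n p} (hv : v ∈ L n p) : X i v ∈ L n p := by
  rw [L, Submodule.mem_sInf] at hv ⊢
  exact fun W hW => (hW.2 i v (hv W hW)).1

theorem D_mem_L (i : Fin n) {v : CliffPoly n p} (hv : v ∈ L n p) : D i v ∈ L n p := by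
  rw [L, Submodule.mem_sInf] at hv ⊢
  exact fun W hW => (hW.2 i v (hv W hW)).2

/-- The parities of the degrees of `x^γ` in the variables `x_{1,α}, …, x_{n,α}`. -/
def columnParity (γ : Fin n × Fin p →₀ ℕ) (α : Fin p) : ZMod 2 := ∑ i, (γ (i, α) : ZMod 2)

theorem columnParity_add_single (γ : Fin n × Fin p →₀ ℕ) (i : Fin n) (α : Fin p) :
    columnParity (γ + Finsupp.single (i, α) 1) = columnParity γ + Pi.single α 1 := by
  classical
  funext β
  simp only [columnParity, Finsupp.add_apply, Nat.cast_add, Finset.sum_add_distrib, Pi.add_apply]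
  congr 1
  by_cases h : α = β
  · subst h
    simp [Finsupp.single_apply]
  · simp [Ne.symm h]

/-- Each term of X_i or D_i changes the degree in column α and the exponent of e_α together, modulo
2. Inside `L n p` a monomial is therefore determined by its polynomial part. -/
theorem L_le_parity : L n p ≤ supportedOn {b | b.2 = columnParity b.1} := by
  refine L_le ?_ fun i w hw => ⟨X_mem_supportedOn i ?_ hw, D_mem_supportedOn i ?_ hw⟩
  · rw [vac_eq]
    refine monomialBasis_mem_supportedOn ?_
    funext α
    simp [columnParity]
  · rintro ⟨γ, η⟩ hb α
    simp only [Set.mem_ofPred_eq] at hb ⊢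
    rw [hb, columnParity_add_single]
  · rintro ⟨γ, η⟩ hb α h0
    simp only [Set.mem_ofPred_eq] at hb h0 ⊢
    have : γ = (γ - Finsupp.single (i, α) 1) + Finsupp.single (i, α) 1 := by
      rw [tsub_add_cancel_of_le]
      rw [Finsupp.single_le_iff]
      omega
    rw [hb]
    conv_lhs => rw [this, columnParity_add_single, shift_shift]

/-! ### Rotation invariance -/

/-- The derivation `∑_i x_{i,β} ∂_{i,α} - x_{i,α} ∂_{i,β}`. -/
def rotation (n : ℕ) {p : ℕ} (α β : Fin p) :
    Derivation ℂ (MvPolynomial (Fin n × Fin p) ℂ) (MvPolynomial (Fin n × Fin p) ℂ) :=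
  ∑ i : Fin n, ((MvPolynomial.X (i, β) : MvPolynomial (Fin n × Fin p) ℂ) •
    MvPolynomial.pderiv (i, α) - (MvPolynomial.X (i, α) : MvPolynomial (Fin n × Fin p) ℂ) •
      MvPolynomial.pderiv (i, β))

theorem rotation_apply (α β : Fin p) (f : MvPolynomial (Fin n × Fin p) ℂ) :
    rotation n α β f = ∑ i, (MvPolynomial.X (i, β) * MvPolynomial.pderiv (i, α) f
      - MvPolynomial.X (i, α) * MvPolynomial.pderiv (i, β) f) := by
  rw [rotation, ← Derivation.coeFnAddMonoidHom_apply, map_sum, Finset.sum_apply]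
  simp

theorem rotation_X {α β : Fin p} (i : Fin n) (γ : Fin p) :
    rotation n α β (MvPolynomial.X (i, γ))
      = (if γ = α then MvPolynomial.X (i, β) else 0)
        - if γ = β then MvPolynomial.X (i, α) else 0 := by
  rw [rotation_apply, Finset.sum_eq_single i]
  · simp only [MvPolynomial.pderiv_X, Pi.single_apply, Prod.mk.injEq, true_and]
    split_ifs <;> simp
  · intro j _ hj
    simp [MvPolynomial.pderiv_X, hj.symm]
  · simp

/-- The commutator of two derivations is a derivation, so it suffices to compare values on the
variables. -/
theorem rotation_pderiv {α β : Fin p} (i : Fin n) (γ : Fin p)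
    (f : MvPolynomial (Fin n × Fin p) ℂ) :
    rotation n α β (MvPolynomial.pderiv (i, γ) f)
      = MvPolynomial.pderiv (i, γ) (rotation n α β f)
        + ((if γ = α then MvPolynomial.pderiv (i, β) f else 0)
        - if γ = β then MvPolynomial.pderiv (i, α) f else 0) := by
  have : ⁅rotation n α β, (MvPolynomial.pderiv (i, γ) : Derivation ℂ _ _)⁆
      = (if γ = α then MvPolynomial.pderiv (i, β) else 0)
        - if γ = β then MvPolynomial.pderiv (i, α) else 0 := by
    refine MvPolynomial.derivation_ext fun ⟨j, κ⟩ => ?_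
    rw [Derivation.commutator_apply, rotation_X, MvPolynomial.pderiv_X, Pi.single_apply]
    by_cases h1 : γ = α <;> by_cases h2 : γ = β <;> by_cases h3 : κ = α <;> by_cases h4 : κ = β <;>
      by_cases h5 : i = j <;> by_cases h6 : κ = γ <;>
      simp_all [MvPolynomial.pderiv_X, Pi.single_apply, Ne.symm, eq_comm] 
  have h := DFunLike.congr_fun this f
  rw [Derivation.commutator_apply, sub_eq_iff_eq_add'] at h
  rw [h]
  congr 1
  split_ifs <;> simp

end Generators

section Invariance

variable {n p : ℕ}

/-- The derivation `½ [e_α e_β, ·]` of the Clifford algebra. -/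
def cliffordRotation {p : ℕ} (α β : Fin p) : Module.End ℂ (Cl p) :=
  (1 / 2 : ℂ) • (LinearMap.mulLeft ℂ (e α * e β) - LinearMap.mulRight ℂ (e α * e β))

theorem e_mul_e_mul_e (α β γ : Fin p) :
    (e α * e β * e γ : Cl p) = e γ * (e α * e β) + (if γ = β then (2 : ℂ) • e α else 0)
      - if γ = α then (2 : ℂ) • e β else 0 := by
  have h1 : (e β * e γ : Cl p) = (if β = γ then 2 else 0) - e γ * e β :=
    eq_sub_of_add_eq (e_anticomm β γ)
  have h2 : (e α * e γ : Cl p) = (if α = γ then 2 else 0) - e γ * e α :=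
    eq_sub_of_add_eq (e_anticomm α γ)
  rw [mul_assoc, h1, mul_sub, ← mul_assoc, h2, sub_mul, mul_assoc]
  have h3 : ∀ w : Cl p, (2 : ℂ) • w = 2 * w := fun w => by rw [two_smul, two_mul]
  have h4 : ∀ w : Cl p, (2 : ℂ) • w = w * 2 := fun w => by rw [two_smul, mul_two]
  rw [h3 (e β), h4 (e α)]
  rw [if_congr (eq_comm (a := γ) (b := β)) rfl rfl, if_congr (eq_comm (a := γ) (b := α)) rfl rfl]
  split_ifs <;> (try simp) <;> abel

theorem cliffordRotation_e_mul (α β γ : Fin p) (u : Cl p) :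
    cliffordRotation α β (e γ * u) = e γ * cliffordRotation α β u
      + (if γ = β then e α * u else 0) - if γ = α then e β * u else 0 := by
  simp only [cliffordRotation, LinearMap.smul_apply, LinearMap.sub_apply, LinearMap.mulLeft_apply,
    LinearMap.mulRight_apply]
  rw [← mul_assoc (e α * e β), e_mul_e_mul_e, mul_smul_comm, mul_sub, add_sub_assoc, add_mul]
  have h : (1 / 2 : ℂ) • (((if γ = β then (2 : ℂ) • e α else 0)
      - if γ = α then (2 : ℂ) • e β else 0) * u)
      = (if γ = β then e α * u else 0) - if γ = α then e β * u else 0 := by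
    rw [sub_mul, smul_sub, ite_mul, ite_mul]
    split_ifs <;> simp [smul_smul]
  refine Eq.trans ?_ (add_sub_assoc _ _ _).symm
  rw [← h, ← smul_add]
  congr 1
  rw [mul_assoc (e γ), mul_assoc (e γ)]
  abel

/-- The action of an infinitesimal rotation in the `(α, β)` plane. -/
def rotationOp (n : ℕ) {p : ℕ} (α β : Fin p) : Module.End ℂ (CliffPoly n p) :=
  TensorProduct.map (rotation n α β : _ →ₗ[ℂ] _) LinearMap.id
    - TensorProduct.map LinearMap.id (cliffordRotation α β)

theorem rotationOp_tmul (α β : Fin p) (f : MvPolynomial (Fin n × Fin p) ℂ) (u : Cl p) :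
    rotationOp n α β (f ⊗ₜ u) = rotation n α β f ⊗ₜ u - f ⊗ₜ cliffordRotation α β u := rfl

/-- Under the rotation both a_γ and e_γ transform like the coordinates of a vector, so ∑ a_γ ⊗ e_γ
is invariant: the corrections at γ = α and γ = β cancel. Taking multiplication by x_{i,γ} or ∂_{i,γ}
for a_γ covers both kinds of generators. -/
theorem rotationOp_commute (α β : Fin p)
    (a : Fin p → Module.End ℂ (MvPolynomial (Fin n × Fin p) ℂ))
    (ha : ∀ γ f, rotation n α β (a γ f) = a γ (rotation n α β f)
      + ((if γ = α then a β f else 0) - if γ = β then a α f else 0)) (v : CliffPoly n p) :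
    rotationOp n α β ((∑ γ, TensorProduct.map (a γ) (LinearMap.mulLeft ℂ (e γ))) v)
      = (∑ γ, TensorProduct.map (a γ) (LinearMap.mulLeft ℂ (e γ))) (rotationOp n α β v) := by
  induction v using TensorProduct.induction_on with
  | zero => simp
  | add v w hv hw => rw [map_add, map_add, map_add, map_add, hv, hw]
  | tmul f u =>
    have h : ∀ γ, rotationOp n α β (a γ f ⊗ₜ (e γ * u))
        = TensorProduct.map (a γ) (LinearMap.mulLeft ℂ (e γ)) (rotationOp n α β (f ⊗ₜ u))
          + ((if γ = α then a β f ⊗ₜ[ℂ] (e α * u) + a α f ⊗ₜ[ℂ] (e β * u) else 0)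
            - if γ = β then a β f ⊗ₜ[ℂ] (e α * u) + a α f ⊗ₜ[ℂ] (e β * u) else 0) := by
      intro γ
      rw [rotationOp_tmul, rotationOp_tmul, map_sub, TensorProduct.map_tmul,
        TensorProduct.map_tmul, LinearMap.mulLeft_apply, LinearMap.mulLeft_apply, ha,
        cliffordRotation_e_mul, TensorProduct.add_tmul, TensorProduct.sub_tmul,
        TensorProduct.tmul_sub, TensorProduct.tmul_add]
      by_cases h1 : γ = α <;> by_cases h2 : γ = β
      · subst h1; subst h2; simp
      · subst h1; simp [h2]; abel
      · subst h2; simp [h1]; abel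
      · simp [h1, h2]
    simp only [LinearMap.sum_apply, TensorProduct.map_tmul, LinearMap.mulLeft_apply, map_sum, h]
    rw [Finset.sum_add_distrib, Finset.sum_sub_distrib]
    simp

theorem rotationOp_X (α β : Fin p) (i : Fin n) (v : CliffPoly n p) :
    rotationOp n α β (X i v) = X i (rotationOp n α β v) := by
  refine rotationOp_commute α β (fun γ => LinearMap.mulLeft ℂ (MvPolynomial.X (i, γ)))
    (fun γ f => ?_) v
  simp only [LinearMap.mulLeft_apply]
  rw [Derivation.leibniz, rotation_X, smul_eq_mul, smul_eq_mul, mul_sub]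
  split_ifs <;> ring

theorem rotationOp_D (α β : Fin p) (i : Fin n) (v : CliffPoly n p) :
    rotationOp n α β (D i v) = D i (rotationOp n α β v) :=
  rotationOp_commute α β (fun γ => ((MvPolynomial.pderiv (i, γ) :
    Derivation ℂ (MvPolynomial (Fin n × Fin p) ℂ) (MvPolynomial (Fin n × Fin p) ℂ)) :
      MvPolynomial (Fin n × Fin p) ℂ →ₗ[ℂ] MvPolynomial (Fin n × Fin p) ℂ))
    (fun γ f => rotation_pderiv i γ f) v

theorem rotationOp_eq_zero (α β : Fin p) {v : CliffPoly n p} (hv : v ∈ L n p) :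
    rotationOp n α β v = 0 := by
  have : L n p ≤ LinearMap.ker (rotationOp n α β) := by
    refine L_le ?_ fun i w hw => ?_
    · rw [LinearMap.mem_ker, vac, rotationOp_tmul]
      simp [cliffordRotation]
    · rw [LinearMap.mem_ker] at hw
      rw [LinearMap.mem_ker, LinearMap.mem_ker, rotationOp_X, rotationOp_D, hw, map_zero, map_zero]
      exact ⟨rfl, rfl⟩
  exact this hv

/-- The polynomial coefficient of `e^η`. -/
def slice (n : ℕ) {p : ℕ} (η : Fin p → ZMod 2) :
    CliffPoly n p →ₗ[ℂ] MvPolynomial (Fin n × Fin p) ℂ :=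
  (TensorProduct.rid ℂ _).toLinearMap ∘ₗ
    TensorProduct.map LinearMap.id ((cliffordBasis p).coord η)

theorem slice_tmul (η : Fin p → ZMod 2) (f : MvPolynomial (Fin n × Fin p) ℂ) (u : Cl p) :
    slice n η (f ⊗ₜ u) = (cliffordBasis p).repr u η • f := by
  simp [slice]

theorem coeff_slice (η : Fin p → ZMod 2) (v : CliffPoly n p) (γ : Fin n × Fin p →₀ ℕ) :
    (slice n η v).coeff γ = (monomialBasis n p).repr v (γ, η) := by
  induction v using TensorProduct.induction_on with
  | zero => simp
  | add v w hv hw => rw [map_add, MvPolynomial.coeff_add, hv, hw, map_add, Finsupp.add_apply]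
  | tmul f u => rw [slice_tmul, monomialBasis_repr_tmul, MvPolynomial.coeff_smul, smul_eq_mul,
      mul_comm]

theorem repr_map_left (g : Module.End ℂ (MvPolynomial (Fin n × Fin p) ℂ)) (v : CliffPoly n p)
    (γ : Fin n × Fin p →₀ ℕ) (η : Fin p → ZMod 2) :
    (monomialBasis n p).repr (TensorProduct.map g LinearMap.id v) (γ, η)
      = (g (slice n η v)).coeff γ := by
  rw [← coeff_slice]
  congr 1
  induction v using TensorProduct.induction_on with
  | zero => simp
  | add v w hv hw => rw [map_add, map_add, map_add, map_add, hv, hw]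
  | tmul f u => rw [TensorProduct.map_tmul, slice_tmul, slice_tmul, map_smul, LinearMap.id_apply]

theorem coeff_rotation {α β : Fin p} (hαβ : α ≠ β) (f : MvPolynomial (Fin n × Fin p) ℂ)
    (m : Fin n × Fin p →₀ ℕ) :
    (rotation n α β f).coeff m
      = ∑ i, (if m (i, β) ≠ 0 then
          f.coeff (m - Finsupp.single (i, β) 1 + Finsupp.single (i, α) 1) * (m (i, α) + 1) else 0)
        - ∑ i, (if m (i, α) ≠ 0 then
          f.coeff (m - Finsupp.single (i, α) 1 + Finsupp.single (i, β) 1) * (m (i, β) + 1)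
            else 0) := by
  classical
  rw [rotation_apply, MvPolynomial.coeff_sum, ← Finset.sum_sub_distrib]
  refine Finset.sum_congr rfl fun i _ => ?_
  rw [MvPolynomial.coeff_sub, MvPolynomial.coeff_X_mul', MvPolynomial.coeff_X_mul',
    MvPolynomial.coeff_pderiv, MvPolynomial.coeff_pderiv]
  simp [hαβ, hαβ.symm]

/-- The relations between the coordinates of a vector of `L_n(p)` that come from its invariance
under rotations. -/
theorem sum_repr_eq {α β : Fin p} (hαβ : α ≠ β) {v : CliffPoly n p} (hv : v ∈ L n p)
    (η : Fin p → ZMod 2) (m : Fin n × Fin p →₀ ℕ)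
    (hm : ∀ η', (monomialBasis n p).repr v (m, η') = 0) :
    ∑ i, (if m (i, β) ≠ 0 then (monomialBasis n p).repr v
        (m - Finsupp.single (i, β) 1 + Finsupp.single (i, α) 1, η) * (m (i, α) + 1) else 0)
      = ∑ i, (if m (i, α) ≠ 0 then (monomialBasis n p).repr v
        (m - Finsupp.single (i, α) 1 + Finsupp.single (i, β) 1, η) * (m (i, β) + 1) else 0) := by
  have h1 := rotationOp_eq_zero α β hv
  rw [rotationOp, LinearMap.sub_apply, sub_eq_zero] at h1
  -- The Clifford half of the rotation leaves the exponents of x unchanged. As v has no monomial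
  -- with exponents m, the polynomial half must also have zero coefficients there.
  have h2 : TensorProduct.map LinearMap.id (cliffordRotation α β) v
      ∈ supportedOn {b : MonomialIndex n p | b.1 ≠ m} := by
    refine map_mem_supportedOn (S := {b | b.1 ≠ m}) _ (fun b hb => ?_) ?_
    · rw [monomialBasis_eq, TensorProduct.map_tmul]
      exact tmul_mem_supportedOn _ _ fun η => hb
    · rw [mem_supportedOn]
      rintro ⟨γ, η'⟩ hb rfl
      exact hb (hm η')
  rw [← h1] at h2
  have h3 : (monomialBasis n p).repr
      (TensorProduct.map (rotation n α β : _ →ₗ[ℂ] _) LinearMap.id v) (m, η) = 0 := by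
    by_contra h
    exact mem_supportedOn.mp h2 _ h rfl
  rw [repr_map_left, Derivation.coeFn_coe, coeff_rotation hαβ, sub_eq_zero] at h3
  simpa only [coeff_slice] using h3

/-! ### Extremal monomials of invariant vectors and the lattice condition. -/

/-- The degree of `x^γ` in the variables `x_{1,α}, …, x_{n,α}`, for each `α`. -/
def columnDegree (γ : Fin n × Fin p →₀ ℕ) (α : Fin p) : ℕ := ∑ i, γ (i, α)

/-- The exponents obtained from `γ` by moving `x_{i,α}` and `x_{i,β}`, with `b_i` factors `x_{i,β}`
in the result. -/
def redistribute (γ : Fin n × Fin p →₀ ℕ) (α β : Fin p) (b : Fin n →₀ ℕ) : Fin n × Fin p →₀ ℕ :=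
  Finsupp.equivFunOnFinite.symm fun x =>
    if x.2 = α then γ (x.1, α) + γ (x.1, β) - b x.1 else if x.2 = β then b x.1 else γ x

theorem redistribute_left (γ : Fin n × Fin p →₀ ℕ) (α β : Fin p) (b : Fin n →₀ ℕ) (i : Fin n) :
    redistribute γ α β b (i, α) = γ (i, α) + γ (i, β) - b i := by
  simp [redistribute]

theorem redistribute_right (γ : Fin n × Fin p →₀ ℕ) {α β : Fin p} (h : α ≠ β) (b : Fin n →₀ ℕ)
    (i : Fin n) : redistribute γ α β b (i, β) = b i := by
  simp [redistribute, h.symm]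

theorem redistribute_of_ne (γ : Fin n × Fin p →₀ ℕ) {α β κ : Fin p} (h1 : κ ≠ α) (h2 : κ ≠ β)
    (b : Fin n →₀ ℕ) (i : Fin n) : redistribute γ α β b (i, κ) = γ (i, κ) := by
  simp [redistribute, h1, h2]

theorem redistribute_add_single (γ : Fin n × Fin p →₀ ℕ) {α β : Fin p} (h : α ≠ β)
    {b : Fin n →₀ ℕ} {i : Fin n} (hi : b i < γ (i, α) + γ (i, β)) :
    redistribute γ α β (b + Finsupp.single i 1)
      = redistribute γ α β b - Finsupp.single (i, α) 1 + Finsupp.single (i, β) 1 := by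
  classical
  ext ⟨j, κ⟩
  rw [Finsupp.add_apply, Finsupp.tsub_apply, Finsupp.single_apply, Finsupp.single_apply]
  by_cases h1 : κ = α
  · subst h1
    rw [redistribute_left, redistribute_left, Finsupp.add_apply, Finsupp.single_apply]
    by_cases hj : i = j <;> simp [hj, h.symm]
    omega
  · by_cases h2 : κ = β
    · subst h2
      rw [redistribute_right γ h, redistribute_right γ h, Finsupp.add_apply, Finsupp.single_apply]
      by_cases hj : i = j <;> simp [hj, h]
    · rw [redistribute_of_ne γ h1 h2, redistribute_of_ne γ h1 h2]
      simp [Ne.symm h1, Ne.symm h2]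

theorem columnDegree_add (γ δ : Fin n × Fin p →₀ ℕ) :
    columnDegree (γ + δ) = columnDegree γ + columnDegree δ := by
  funext α
  simp [columnDegree, Finset.sum_add_distrib]

theorem columnDegree_single (i : Fin n) (α : Fin p) :
    columnDegree (Finsupp.single (i, α) 1) = Pi.single α 1 := by
  classical
  funext β
  by_cases h : α = β
  · subst h
    simp [columnDegree, Finsupp.single_apply]
  · simp [columnDegree, Ne.symm h]

/-- The extremal monomial plays the part of a highest weight vector for the rotations: raising it
from column β to column α must give zero, and this constrains its exponents. -/
theorem exists_lattice_monomial {v : CliffPoly n p} (hv : v ∈ L n p) (hv0 : v ≠ 0) :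
    ∃ b : MonomialIndex n p, (monomialBasis n p).repr v b ≠ 0 ∧
      ∀ (α β : Fin p), (α : ℕ) + 1 = β → ∀ k,
        ∑ i ∈ Finset.Iic k, b.1 (i, β) ≤ ∑ i ∈ Finset.Iio k, b.1 (i, α) := by
  set c := (monomialBasis n p).repr v with hc
  have hne : c.support.Nonempty := by
    rw [Finsupp.support_nonempty_iff, hc]
    simpa using hv0
  -- Column degrees come first, so that rotation relations truncate; the exponents read row by row
  -- then select one monomial among those with the same column degrees. The Clifford index plays no
  -- part in the comparison.
  obtain ⟨⟨γ, η⟩, hγ, hmax⟩ := Finset.exists_max_image c.support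
    (fun b : MonomialIndex n p =>
      (toLex (toLex (columnDegree b.1), toLex fun i => toLex fun α => b.1 (i, α)) :
        Lex (Lex (Fin p → ℕ) × Lex (Fin n → Lex (Fin p → ℕ))))) hne
  have hcol : ∀ b, c b ≠ 0 → ∀ α, (∀ κ < α, columnDegree b.1 κ = columnDegree γ κ) →
      columnDegree b.1 α ≤ columnDegree γ α := by
    intro b hb α hα
    by_contra! h
    refine absurd (hmax b (Finsupp.mem_support_iff.mpr hb)) (not_le_of_gt ?_)
    rw [Prod.Lex.toLex_lt_toLex]
    exact Or.inl ⟨α, fun κ hκ => (hα κ hκ).symm, h⟩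
  have hrow : ∀ b, c b ≠ 0 → columnDegree b.1 = columnDegree γ → ∀ k α,
      (∀ i < k, ∀ κ, b.1 (i, κ) = γ (i, κ)) → (∀ κ < α, b.1 (k, κ) = γ (k, κ)) →
      b.1 (k, α) ≤ γ (k, α) := by
    intro b hb hd k α h1 h2
    by_contra! h
    refine absurd (hmax b (Finsupp.mem_support_iff.mpr hb)) (not_le_of_gt ?_)
    rw [Prod.Lex.toLex_lt_toLex]
    refine Or.inr ⟨congrArg toLex hd.symm, k, fun i hi => ?_, α, fun κ hκ => (h2 κ hκ).symm, h⟩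
    exact congrArg toLex (funext fun κ => (h1 i hi κ).symm)
  refine ⟨(γ, η), Finsupp.mem_support_iff.mp hγ, fun α β hαβ k => ?_⟩
  have hlt : α < β := by rw [Fin.lt_def]; omega
  set d : Fin n →₀ ℕ := Finsupp.equivFunOnFinite.symm fun i => γ (i, α) + γ (i, β) with hd
  have hdi : ∀ i, d i = γ (i, α) + γ (i, β) := fun i => rfl
  have hsum : ∑ i, d i = columnDegree γ α + columnDegree γ β := by
    simp [hdi, columnDegree, Finset.sum_add_distrib]
  have hleft : ∀ b ≤ d, columnDegree (redistribute γ α β b) α + ∑ i, b i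
      = columnDegree γ α + columnDegree γ β := by
    intro b hb
    rw [← hsum, columnDegree, ← Finset.sum_add_distrib]
    refine Finset.sum_congr rfl fun i _ => ?_
    rw [redistribute_left, ← hdi]
    exact Nat.sub_add_cancel (hb i)
  have hright : ∀ b, columnDegree (redistribute γ α β b) β = ∑ i, b i := fun b =>
    Finset.sum_congr rfl fun i _ => redistribute_right γ hlt.ne b i
  have hother : ∀ b κ, κ ≠ α → κ ≠ β →
      columnDegree (redistribute γ α β b) κ = columnDegree γ κ := fun b κ h1 h2 =>
    Finset.sum_congr rfl fun i _ => redistribute_of_ne γ h1 h2 b i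
  -- The exponent b_i records the factors x_{i,β}; the remaining d_i - b_i factors are x_{i,α}.
  -- Fixing ∑ b_i fixes all column degrees.
  set q : MvPolynomial (Fin n) ℂ := ∑ b ∈ (Finset.Iic d).filter
    (fun b => ∑ i, b i = columnDegree γ β), MvPolynomial.monomial b (c (redistribute γ α β b, η))
    with hq
  have hqc : ∀ b, q.coeff b = if b ≤ d ∧ ∑ i, b i = columnDegree γ β then
      c (redistribute γ α β b, η) else 0 := by
    intro b
    rw [hq, MvPolynomial.coeff_sum]
    simp only [MvPolynomial.coeff_monomial, Finset.sum_ite_eq', Finset.mem_filter, Finset.mem_Iic]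
  have hinv : ∑ i, MvPolynomial.pderiv i q = 0 := by
    ext b
    rw [MvPolynomial.coeff_sum, MvPolynomial.coeff_zero]
    simp only [MvPolynomial.coeff_pderiv, hqc]
    have hb1 : ∀ i, ∑ j, (b + Finsupp.single i 1 : Fin n →₀ ℕ) j = ∑ j, b j + 1 := by
      intro i
      simp [Finset.sum_add_distrib, Finsupp.single_apply]
    by_cases hb : b ≤ d ∧ ∑ i, b i + 1 = columnDegree γ β
    · have hL := hleft b hb.1
      -- Here b has one factor too few in column β, so column α exceeds its maximal degree by one
      -- and v has no such monomial. This permits the rotation relation at these exponents.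
      have h0 : ∀ η', c (redistribute γ α β b, η') = 0 := by
        intro η'
        by_contra h
        have := hcol _ h α fun κ hκ => hother b κ hκ.ne (hκ.trans hlt).ne
        simp only at this
        omega
      have key := sum_repr_eq hlt.ne hv η _ h0
      -- The left side of the relation involves monomials whose degree in column α is two above the
      -- maximum, hence absent. The right side is the coefficient of ∑ ∂_i q at b; indices with b_i
      -- = d_i contribute nothing to either.
      rw [Finset.sum_eq_zero] at key
      · refine Eq.trans ?_ key.symm
        refine Finset.sum_congr rfl fun i _ => ?_
        rw [hb1, redistribute_left, redistribute_right γ hlt.ne, ← hdi]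
        by_cases hi : b i < d i
        · have hle : b + Finsupp.single i 1 ≤ d := by
            intro j
            rw [Finsupp.add_apply, Finsupp.single_apply]
            split_ifs with hj
            · subst hj; exact hi
            · exact hb.1 j
          rw [if_pos ⟨hle, hb.2⟩, if_pos (by omega)]
          rw [redistribute_add_single γ hlt.ne hi]
        · have hle : ¬ b + Finsupp.single i 1 ≤ d := by
            intro h
            have := h i
            simp at this
            omega
          rw [if_neg (fun h => hle h.1), if_neg (by omega), zero_mul]
      · intro i _
        split_ifs with hi
        · rw [mul_eq_zero]
          left
          by_contra h
          have hd' : ∀ κ, columnDegree (redistribute γ α β b - Finsupp.single (i, β) 1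
              + Finsupp.single (i, α) 1) κ = if κ = α then columnDegree (redistribute γ α β b) α + 1
                else if κ = β then columnDegree (redistribute γ α β b) β - 1 else
                  columnDegree (redistribute γ α β b) κ := by
            intro κ
            have h1 := columnDegree_add (redistribute γ α β b - Finsupp.single (i, β) 1)
              (Finsupp.single (i, β) 1)
            rw [tsub_add_cancel_of_le (by rw [Finsupp.single_le_iff]; omega)] at h1
            rw [columnDegree_add, h1, columnDegree_single, columnDegree_single]
            by_cases h2 : κ = α
            · subst h2
              simp [hlt.ne]
            · by_cases h3 : κ = β
              · subst h3
                simp [h2]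
              · simp [h2, h3]
          have := hcol _ h α fun κ hκ => by
            simp only [hd']
            rw [if_neg hκ.ne, if_neg (hκ.trans hlt).ne, hother b κ hκ.ne (hκ.trans hlt).ne]
          simp only [hd', if_true] at this
          omega
        · rfl
    · refine Finset.sum_eq_zero fun i _ => ?_
      rw [if_neg, zero_mul]
      rintro ⟨h1, h2⟩
      rw [hb1] at h2
      exact hb ⟨le_trans (by simp) h1, h2⟩
  have hb0 : (Finsupp.equivFunOnFinite.symm fun i => γ (i, β) : Fin n →₀ ℕ) ∈ q.support := by
    rw [MvPolynomial.mem_support_iff, hqc, if_pos]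
    · convert Finsupp.mem_support_iff.mp hγ using 3
      ext ⟨i, κ⟩
      simp only [redistribute, Finsupp.equivFunOnFinite_symm_apply_apply]
      split_ifs with h1 h2
      · rw [h1, Nat.add_sub_cancel]
      · rw [h2]
      · rfl
    · exact ⟨fun i => by simp [hdi], rfl⟩
  have hsupp : ∀ b ∈ q.support, b ≤ d ∧ ∑ i, b i = columnDegree γ β ∧
      c (redistribute γ α β b, η) ≠ 0 := by
    intro b hb
    rw [MvPolynomial.mem_support_iff, hqc] at hb
    split_ifs at hb with h
    · exact ⟨h.1, h.2, hb⟩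
    · exact absurd rfl hb
  -- Translation invariance allows s = 0. Since column α precedes β in the row comparison and its
  -- exponents are d_i - b_i, the largest monomial of v corresponds to the lexicographically
  -- smallest monomial of q.
  have := PolynomialShift.sum_exponents_le 0 d q
    (PolynomialShift.natDegree_shift_eq_zero hinv).le (fun b hb => (hsupp b hb).1) _ hb0
    (fun b hb k hk => by
      obtain ⟨h1, h2, h3⟩ := hsupp b hb
      have hL := hleft b h1
      have hcd : columnDegree (redistribute γ α β b) = columnDegree γ := by
        funext κ
        by_cases hκα : κ = α
        · subst hκα; omega
        · by_cases hκβ : κ = β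
          · subst hκβ; rw [hright, h2]
          · exact hother b κ hκα hκβ
      have := hrow _ h3 hcd k α (fun i hi κ => by
          have hbi : b i = γ (i, β) := hk i hi
          simp only [redistribute, Finsupp.equivFunOnFinite_symm_apply_apply]
          split_ifs with h1 h2
          · rw [h1, hbi, Nat.add_sub_cancel]
          · rw [h2, hbi]
          · rfl) (fun κ hκ => redistribute_of_ne γ hκ.ne (hκ.trans hlt).ne b k)
      simp only [redistribute_left] at this
      have := h1 k
      rw [hdi] at this
      simp only [Finsupp.equivFunOnFinite_symm_apply_apply]
      omega) k
  simpa [hdi] using this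

end Invariance

/-! ### Column operators -/

section Antisymmetrization

theorem prod_ofFn_swap {R : Type*} [Ring R] {k : ℕ} (y : Fin (k + 1) → R)
    (hy : ∀ a b, a ≠ b → y a * y b = - (y b * y a)) (i : Fin k) :
    (List.ofFn fun r => y (Equiv.swap i.castSucc i.succ r)).prod = - (List.ofFn y).prod := by
  induction k with
  | zero => exact i.elim0
  | succ k ih =>
    induction i using Fin.cases with
    | zero =>
      have h : ∀ r : Fin k, Equiv.swap (Fin.castSucc 0) (Fin.succ 0) r.succ.succ
          = (r.succ.succ : Fin (k + 2)) := fun r =>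
        Equiv.swap_apply_of_ne_of_ne (by simp) (by simp [Fin.ext_iff])
      simp only [List.ofFn_succ, List.prod_cons, h]
      rw [← mul_assoc, ← mul_assoc, ← neg_mul]
      congr 1
      have h0 : Equiv.swap (Fin.castSucc (0 : Fin (k + 1))) (Fin.succ 0) 0 = Fin.succ 0 :=
        Equiv.swap_apply_left _ _
      have h1 : Equiv.swap (Fin.castSucc (0 : Fin (k + 1))) (Fin.succ 0) (Fin.succ 0) = 0 :=
        Equiv.swap_apply_right _ _
      rw [h0, h1]
      exact hy _ _ (by simp)
    | succ i =>
      rw [List.ofFn_succ, List.ofFn_succ (f := y), List.prod_cons, List.prod_cons, ← mul_neg]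
      have h0 : Equiv.swap i.succ.castSucc i.succ.succ 0 = 0 :=
        Equiv.swap_apply_of_ne_of_ne (by simp [Fin.ext_iff]) (Fin.succ_ne_zero _).symm
      have h1 : ∀ r : Fin (k + 1), Equiv.swap i.succ.castSucc i.succ.succ r.succ
          = (Equiv.swap i.castSucc i.succ r).succ := by
        intro r
        rw [← Fin.succ_castSucc]
        exact Function.Injective.swap_apply (Fin.succ_injective _) _ _ _
      rw [h0]
      simp only [h1]
      rw [ih (fun r => y r.succ) (fun a b hab => hy _ _ (by simpa using hab)) i]

theorem prod_ofFn_perm {R : Type*} [Ring R] {k : ℕ} (y : Fin k → R)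
    (hy : ∀ a b, a ≠ b → y a * y b = - (y b * y a)) (σ : Equiv.Perm (Fin k)) :
    (List.ofFn fun r => y (σ r)).prod = (Equiv.Perm.sign σ : ℤ) • (List.ofFn y).prod := by
  cases k with
  | zero => simp [Subsingleton.elim σ 1]
  | succ k =>
    have hσ : σ ∈ Submonoid.closure
        (Set.range fun i : Fin k => Equiv.swap i.castSucc i.succ) := by
      rw [Equiv.Perm.mclosure_swap_castSucc_succ]
      trivial
    induction hσ using Submonoid.closure_induction_right with
    | one => simp
    | mul_right σ _ τ hτ ih =>
      obtain ⟨i, rfl⟩ := hτ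
      have h := prod_ofFn_swap (fun r => y (σ r)) (fun a b hab => hy _ _ (by simpa using hab)) i
      simp only [Equiv.Perm.mul_apply]
      rw [h, ih, Equiv.Perm.sign_mul, Equiv.Perm.sign_swap (Fin.castSucc_lt_succ).ne]
      simp

theorem e_mul_e_of_ne {p : ℕ} {α β : Fin p} (h : α ≠ β) : (e α * e β : Cl p) = - (e β * e α) := by
  have := e_anticomm α β
  rw [if_neg h] at this
  exact eq_neg_of_add_eq_zero_left this

/-- For injective C, reordering anticommuting generators costs exactly the sign, so all k! terms
agree. If two values of C coincide, transposing their positions pairs terms of opposite sign. -/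
theorem sum_sign_smul_prod_e {p k : ℕ} (C : Fin k → Fin p) [Decidable (Function.Injective C)] :
    ∑ σ : Equiv.Perm (Fin k), ((Equiv.Perm.sign σ : ℤ) : ℂ) •
        (List.ofFn fun r => (e (C (σ r)) : Cl p)).prod
      = if Function.Injective C then (k.factorial : ℂ) • (List.ofFn fun r => (e (C r) : Cl p)).prod
        else 0 := by
  split_ifs with hC
  · have h : ∀ σ : Equiv.Perm (Fin k), ((Equiv.Perm.sign σ : ℤ) : ℂ) •
        (List.ofFn fun r => (e (C (σ r)) : Cl p)).prod
        = (List.ofFn fun r => (e (C r) : Cl p)).prod := by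
      intro σ
      rw [prod_ofFn_perm (fun r => (e (C r) : Cl p)) (fun a b hab => e_mul_e_of_ne (hC.ne hab)) σ,
        ← Int.cast_smul_eq_zsmul ℂ, smul_smul, ← Int.cast_mul, Int.units_coe_mul_self, Int.cast_one,
        one_smul]
    simp only [h]
    rw [Finset.sum_const, Finset.card_univ, Fintype.card_perm, Fintype.card_fin,
      Nat.cast_smul_eq_nsmul]
  · simp only [Function.Injective, not_forall] at hC
    obtain ⟨a, b, hab, hne⟩ := hC
    refine Finset.sum_involution (fun σ _ => Equiv.swap a b * σ) ?_ ?_ (fun _ _ => Finset.mem_univ _)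
      (fun σ _ => by simp)
    · intro σ _
      have h : ∀ r, C ((Equiv.swap a b * σ) r) = C (σ r) := by
        intro r
        rw [Equiv.Perm.mul_apply, Equiv.swap_apply_def]
        split_ifs with h1 h2
        · rw [h1, hab]
        · rw [h2, hab]
        · rfl
      simp only [h]
      rw [Equiv.Perm.sign_mul, Equiv.Perm.sign_swap hne, ← add_smul]
      simp
    · intro σ _ _ h
      have h1 := mul_eq_right.mp h
      exact hne (Equiv.swap_eq_one_iff.mp h1)

end Antisymmetrization

section Columns

variable {n p : ℕ}

/-- The operator `∏_r x_{I_r,C_r} e_{C_r}`. -/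
def columnTerm {k : ℕ} (I : Fin k → Fin n) (C : Fin k → Fin p) : Module.End ℂ (CliffPoly n p) :=
  (List.ofFn fun r => mulXE (I r) (C r)).prod

/-- The exponents of `∏_r x_{I_r,C_r}`. -/
def columnExponent {k : ℕ} (I : Fin k → Fin n) (C : Fin k → Fin p) : Fin n × Fin p →₀ ℕ :=
  ∑ r, Finsupp.single (I r, C r) 1

theorem columnTerm_eq_map {k : ℕ} (I : Fin k → Fin n) (C : Fin k → Fin p) :
    columnTerm I C = TensorProduct.map
      (LinearMap.mulLeft ℂ (MvPolynomial.monomial (columnExponent I C) (1 : ℂ)))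
      (LinearMap.mulLeft ℂ (List.ofFn fun r => (e (C r) : Cl p)).prod) := by
  induction k with
  | zero =>
    refine TensorProduct.ext' fun f u => ?_
    simp [columnTerm, columnExponent]
  | succ k ih =>
    have h := ih (fun r => I r.succ) (fun r => C r.succ)
    rw [columnTerm] at h ⊢
    rw [List.ofFn_succ, List.prod_cons, h, mulXE]
    refine TensorProduct.ext' fun f u => ?_
    rw [Module.End.mul_apply, TensorProduct.map_tmul, TensorProduct.map_tmul,
      TensorProduct.map_tmul]
    simp only [LinearMap.mulLeft_apply, List.ofFn_succ, List.prod_cons, ← mul_assoc]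
    rw [columnExponent, columnExponent, Fin.sum_univ_succ, MvPolynomial.X,
      MvPolynomial.monomial_mul, one_mul]

theorem columnTerm_monomialBasis {k : ℕ} (I : Fin k → Fin n) (C : Fin k → Fin p)
    (b : MonomialIndex n p) :
    ∃ (z : ℤˣ) (η : Fin p → ZMod 2),
      (b.2 = columnParity b.1 → η = columnParity (b.1 + columnExponent I C)) ∧
      columnTerm I C (monomialBasis n p b)
        = ((z : ℤ) : ℂ) • monomialBasis n p (b.1 + columnExponent I C, η) := by
  induction k with
  | zero => exact ⟨1, b.2, fun h => by simpa [columnExponent] using h,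
      by simp [columnTerm, columnExponent]⟩
  | succ k ih =>
    obtain ⟨z, η, h1, h2⟩ := ih (fun r => I r.succ) (fun r => C r.succ)
    obtain ⟨z', hz'⟩ := mulXE_monomialBasis (I 0) (C 0)
      (b.1 + columnExponent (fun r => I r.succ) (fun r => C r.succ), η)
    have hexp : columnExponent I C = columnExponent (fun r => I r.succ) (fun r => C r.succ)
        + Finsupp.single (I 0, C 0) 1 := by
      rw [columnExponent, columnExponent, Fin.sum_univ_succ, add_comm]
    refine ⟨z * z', η + Pi.single (C 0) 1, fun h => ?_, ?_⟩
    · rw [h1 h, hexp, ← add_assoc, columnParity_add_single]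
    · rw [columnTerm] at h2 ⊢
      rw [List.ofFn_succ, List.prod_cons, Module.End.mul_apply, h2, map_smul, hz', smul_smul,
        hexp, ← add_assoc]
      push_cast
      rfl

theorem prod_ofFn_X {k : ℕ} (I : Fin k → Fin n) :
    (List.ofFn fun r => (X (I r) : Module.End ℂ (CliffPoly n p))).prod
      = ∑ C : Fin k → Fin p, columnTerm I C := by
  induction k with
  | zero => simp [columnTerm]
  | succ k ih =>
    rw [List.ofFn_succ, List.prod_cons, ih, X_eq_sum, Finset.sum_mul_sum,
      ← (Fin.consEquiv fun _ : Fin (k + 1) => Fin p).sum_comp, Fintype.sum_prod_type]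
    refine Finset.sum_congr rfl fun α _ => Finset.sum_congr rfl fun C _ => ?_
    simp [columnTerm, List.ofFn_succ, Fin.consEquiv]

/-- The operator `X_I / k!`. -/
def columnSum {k : ℕ} (I : Fin k → Fin n) : Module.End ℂ (CliffPoly n p) :=
  ∑ C : Fin k ↪ Fin p, columnTerm I C

/-- After C is permuted along with I, the polynomial factor no longer depends on σ, and only the
antisymmetrization of the e's remains. It supplies the factorial that the normalization of ω̃_A
removes, leaving coefficients ±1. -/
theorem columnOp_eq {k : ℕ} (I : Fin k → Fin n) :
    (columnOp I : Module.End ℂ (CliffPoly n p)) = (k.factorial : ℂ) • columnSum I := by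
  classical
  have h1 : ∀ (C : Fin k → Fin p) (σ : Equiv.Perm (Fin k)),
      columnExponent (fun r => I (σ r)) (fun r => C (σ r)) = columnExponent I C := fun C σ =>
    Equiv.sum_comp σ fun r => Finsupp.single (I r, C r) 1
  have h2 : ∀ σ : Equiv.Perm (Fin k), (List.ofFn fun r : Fin k =>
      (X (I (σ r)) : Module.End ℂ (CliffPoly n p))).prod
      = ∑ C : Fin k → Fin p, columnTerm (fun r => I (σ r)) (fun r => C (σ r)) := by
    intro σ
    rw [prod_ofFn_X]
    exact (Equiv.sum_comp (Equiv.arrowCongr σ.symm (Equiv.refl (Fin p))) _).symm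
  have h3 : ∀ C : Fin k → Fin p, ∑ σ : Equiv.Perm (Fin k), ((Equiv.Perm.sign σ : ℤ) : ℂ) •
      (columnTerm (fun r => I (σ r)) (fun r => C (σ r)) : Module.End ℂ (CliffPoly n p))
      = if Function.Injective C then (k.factorial : ℂ) • columnTerm I C else 0 := by
    intro C
    refine TensorProduct.ext' fun f u => ?_
    simp only [columnTerm_eq_map, h1, LinearMap.sum_apply, LinearMap.smul_apply,
      TensorProduct.map_tmul, LinearMap.mulLeft_apply, ← TensorProduct.tmul_smul,
      ← smul_mul_assoc, ← TensorProduct.tmul_sum, ← Finset.sum_mul]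
    rw [sum_sign_smul_prod_e]
    split_ifs
    · simp
    · simp
  rw [columnOp]
  simp only [h2, Finset.smul_sum]
  rw [Finset.sum_comm]
  simp only [h3]
  rw [← Finset.sum_filter, columnSum, Finset.smul_sum]
  refine (Finset.sum_bij (fun (C : Fin k ↪ Fin p) _ => (C : Fin k → Fin p)) ?_ ?_ ?_ ?_).symm
  · intro C _
    simpa using C.injective
  · intro C _ C' _ h
    exact DFunLike.coe_injective h
  · intro C hC
    exact ⟨⟨C, (Finset.mem_filter.mp hC).2⟩, Finset.mem_univ _, rfl⟩
  · intro C _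
    rfl

/-! ### Corner sums and dominance of monomials. -/

/-- The number of variables `x_{i,α}`, `i < k` and `α < r`, in `x^γ`. -/
def cornerSum (γ : Fin n × Fin p →₀ ℕ) (k r : ℕ) : ℕ :=
  ∑ x : Fin n × Fin p, if (x.1 : ℕ) < k ∧ (x.2 : ℕ) < r then γ x else 0

theorem cornerSum_add (γ δ : Fin n × Fin p →₀ ℕ) :
    cornerSum (γ + δ) = cornerSum γ + cornerSum δ := by
  funext k r
  simp only [cornerSum, Pi.add_apply, ← Finset.sum_add_distrib]
  refine Finset.sum_congr rfl fun x _ => ?_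
  split_ifs <;> simp

theorem cornerSum_zero : cornerSum (0 : Fin n × Fin p →₀ ℕ) = 0 := by
  funext k r
  simp [cornerSum]

theorem cornerSum_single (x : Fin n × Fin p) (k r : ℕ) :
    cornerSum (Finsupp.single x 1) k r = if (x.1 : ℕ) < k ∧ (x.2 : ℕ) < r then 1 else 0 := by
  classical
  rw [cornerSum, Finset.sum_eq_single x]
  · simp
  · intro y _ hy
    simp [hy.symm]
  · simp

theorem cornerSum_sum {ι : Type*} (s : Finset ι) (f : ι → Fin n × Fin p) (k r : ℕ) :
    cornerSum (∑ b ∈ s, Finsupp.single (f b) 1) k r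
      = (s.filter fun b => ((f b).1 : ℕ) < k ∧ ((f b).2 : ℕ) < r).card := by
  classical
  induction s using Finset.induction_on with
  | empty => simp [cornerSum_zero]
  | insert a s ha ih =>
    rw [Finset.sum_insert ha, cornerSum_add, Pi.add_apply, Pi.add_apply, ih, cornerSum_single,
      Finset.filter_insert]
    split_ifs
    · rw [Finset.card_insert_of_notMem (by simp [ha]), add_comm]
    · rw [zero_add]

theorem rowDegree_columnExponent {k : ℕ} (I : Fin k → Fin n) (C C' : Fin k → Fin p) :
    rowDegree (columnExponent I C) = rowDegree (columnExponent I C') := by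
  have h : ∀ C : Fin k → Fin p, rowDegree (columnExponent I C) = ∑ r, Pi.single (I r) 1 := by
    intro C
    rw [columnExponent]
    let φ : (Fin n × Fin p →₀ ℕ) →+ (Fin n → ℕ) :=
      { toFun := rowDegree
        map_zero' := by funext i; simp [rowDegree]
        map_add' := rowDegree_add }
    exact (map_sum φ _ _).trans (Finset.sum_congr rfl fun r _ => rowDegree_single _ _)
  rw [h, h]

/-- As I increases, the positions with I_s < i form an initial segment, of some size m. The filling
by row numbers puts min(m, r) of them into the first r columns of variables, and an injective
filling cannot put more. -/
theorem cornerSum_columnExponent_le {k : ℕ} {I : Fin k → Fin n} (hI : StrictMono I)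
    {C R : Fin k → Fin p} (hC : Function.Injective C) (hR : ∀ r, (R r : ℕ) = r) :
    cornerSum (columnExponent I C) ≤ cornerSum (columnExponent I R) := by
  intro i r
  rw [columnExponent, columnExponent, cornerSum_sum, cornerSum_sum]
  simp only [hR]
  by_cases h : ∃ s : Fin k, ¬ ((I s : ℕ) < i ∧ (s : ℕ) < r) ∧ (s : ℕ) < r
  · obtain ⟨s, hs, hsr⟩ := h
    have hsi : ¬ (I s : ℕ) < i := fun h => hs ⟨h, hsr⟩
    refine Finset.card_le_card fun t ht => ?_
    rw [Finset.mem_filter] at ht ⊢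
    refine ⟨ht.1, ht.2.1, ?_⟩
    by_contra hlt
    have : I s ≤ I t := hI.monotone (Fin.le_def.mpr (by omega))
    have := Fin.le_def.mp this
    omega
  · push Not at h
    have h1 : ∀ s : Fin k, (s : ℕ) < r → (I s : ℕ) < i := by
      intro s hs
      by_contra hc
      exact absurd hs (not_lt.mpr (h s fun h => absurd h hc))
    have h2 : (Finset.univ.filter fun s : Fin k => (I s : ℕ) < i ∧ (C s : ℕ) < r).card
        ≤ min k r := by
      refine le_min ((Finset.card_filter_le _ _).trans (by simp)) ?_
      refine (Finset.card_le_card_of_injOn (t := Finset.range r) (fun s => (C s : ℕ)) ?_ ?_).trans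
        (by simp)
      · intro s hs
        simpa using (Finset.mem_filter.mp hs).2.2
      · intro s _ t _ hst
        exact hC (Fin.ext hst)
    refine h2.trans ?_
    have h3 : (Finset.univ.filter fun s : Fin k => (I s : ℕ) < i ∧ (s : ℕ) < r)
        = Finset.univ.filter fun s : Fin k => (s : ℕ) < r :=
      Finset.filter_congr fun s _ => ⟨fun h => h.2, fun h => ⟨h1 s h, h⟩⟩
    rw [h3, Fin.card_filter_val_lt]

/-- Suppose the corner sums agree. If C_t = t for all t < s, injectivity gives C_s ≥ s; and C_s > s
would make the corner (I_s + 1, s + 1) count strictly fewer positions for C. So C is the filling by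
row numbers. -/
theorem cornerSum_columnExponent_lt {k : ℕ} {I : Fin k → Fin n} (hI : StrictMono I)
    {C R : Fin k → Fin p} (hC : Function.Injective C) (hR : ∀ r, (R r : ℕ) = r) (h : C ≠ R) :
    cornerSum (columnExponent I C) < cornerSum (columnExponent I R) := by
  refine lt_of_le_of_ne (cornerSum_columnExponent_le hI hC hR) fun heq => h ?_
  have key : ∀ m : ℕ, ∀ s : Fin k, (s : ℕ) = m → (C s : ℕ) = s := by
    intro m
    induction m using Nat.strong_induction_on with
    | _ m ih =>
      intro s hs
      have hge : (s : ℕ) ≤ C s := by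
        by_contra! hlt
        have := ih (C s) (hs ▸ hlt) ⟨C s, hlt.trans s.isLt⟩ rfl
        have h2 := hC (Fin.ext this)
        have h3 := Fin.ext_iff.mp h2
        simp only at h3
        omega
      by_contra hne
      have h1 := congrFun (congrFun heq ((I s : ℕ) + 1)) ((s : ℕ) + 1)
      rw [columnExponent, columnExponent, cornerSum_sum, cornerSum_sum] at h1
      simp only [hR] at h1
      refine absurd h1 (ne_of_lt (Finset.card_lt_card ?_))
      rw [Finset.ssubset_iff_of_subset]
      · refine ⟨s, by simp, ?_⟩
        rw [Finset.mem_filter]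
        rintro ⟨_, _, h2⟩
        omega
      · intro t ht
        rw [Finset.mem_filter] at ht ⊢
        refine ⟨ht.1, ht.2.1, ?_⟩
        have : I t ≤ I s := Fin.le_def.mpr (by omega)
        have := Fin.le_def.mp (hI.le_iff_le.mp this)
        omega
  funext s
  exact Fin.ext ((key s s rfl).trans (hR s).symm)

theorem columnSum_mem_integralVectors {k : ℕ} (I : Fin k → Fin n) {v : CliffPoly n p}
    (hv : v ∈ integralVectors n p) : columnSum I v ∈ integralVectors n p := by
  refine map_mem_integralVectors _ (fun b => ?_) hv
  rw [columnSum, LinearMap.sum_apply]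
  refine AddSubgroup.sum_mem _ fun C _ => ?_
  obtain ⟨z, η, _, hz⟩ := columnTerm_monomialBasis I C b
  rw [hz]
  exact intCast_smul_mem_integralVectors _ (monomialBasis_mem_integralVectors _)

/-- The monomials with the row degrees of `x^γ` that are strictly dominated by `x^γ`. -/
def dominated (γ : Fin n × Fin p →₀ ℕ) : Set (MonomialIndex n p) :=
  {b | cornerSum b.1 < cornerSum γ ∧ rowDegree b.1 = rowDegree γ}

theorem columnTerm_mem_dominated_of_mem {k : ℕ} {I : Fin k → Fin n} (hI : StrictMono I)
    {C R : Fin k → Fin p} (hC : Function.Injective C) (hR : ∀ r, (R r : ℕ) = r)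
    {γ : Fin n × Fin p →₀ ℕ} {v : CliffPoly n p} (hv : v ∈ supportedOn (dominated γ)) :
    columnTerm I C v ∈ supportedOn (dominated (γ + columnExponent I R)) := by
  refine map_mem_supportedOn _ (fun b hb => ?_) hv
  obtain ⟨z, η', _, hz⟩ := columnTerm_monomialBasis I C b
  have hmem : (b.1 + columnExponent I C, η') ∈ dominated (γ + columnExponent I R) := by
    constructor
    · simp only [cornerSum_add]
      exact add_lt_add_of_lt_of_le hb.1 (cornerSum_columnExponent_le hI hC hR)
    · simp only [rowDegree_add]
      rw [hb.2, rowDegree_columnExponent I C R]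
  rw [hz]
  exact Submodule.smul_mem _ _ (monomialBasis_mem_supportedOn hmem)

theorem columnTerm_mem_dominated_of_ne {k : ℕ} {I : Fin k → Fin n} (hI : StrictMono I)
    {C R : Fin k → Fin p} (hC : Function.Injective C) (hR : ∀ r, (R r : ℕ) = r) (h : C ≠ R)
    (γ : Fin n × Fin p →₀ ℕ) (η : Fin p → ZMod 2) :
    columnTerm I C (monomialBasis n p (γ, η))
      ∈ supportedOn (dominated (γ + columnExponent I R)) := by
  obtain ⟨z, η', _, hz⟩ := columnTerm_monomialBasis I C (γ, η)
  have hmem : (γ + columnExponent I C, η') ∈ dominated (γ + columnExponent I R) := by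
    constructor
    · simp only [cornerSum_add]
      exact add_lt_add_of_le_of_lt le_rfl (cornerSum_columnExponent_lt hI hC hR h)
    · simp only [rowDegree_add]
      rw [rowDegree_columnExponent I C R]
  rw [hz]
  exact Submodule.smul_mem _ _ (monomialBasis_mem_supportedOn hmem)

/-- Corner sums are additive, so a new column keeps dominated monomials dominated, and on the
leading monomial every filling other than R gives a dominated one. -/
theorem columnSum_sub_mem {k : ℕ} {I : Fin k → Fin n} (hI : StrictMono I)
    {R : Fin k → Fin p} (hR : ∀ r, (R r : ℕ) = r) {γ : Fin n × Fin p →₀ ℕ}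
    {η : Fin p → ZMod 2} {v : CliffPoly n p} (z : ℂ)
    (hv : v - z • monomialBasis n p (γ, η) ∈ supportedOn (dominated γ)) :
    columnSum I v - z • columnTerm I R (monomialBasis n p (γ, η))
      ∈ supportedOn (dominated (γ + columnExponent I R)) := by
  classical
  obtain ⟨R, rfl⟩ : ∃ R' : Fin k ↪ Fin p, (R' : Fin k → Fin p) = R :=
    ⟨⟨R, fun a b hab => by
      have := congrArg Fin.val hab
      rw [hR, hR] at this
      exact Fin.ext this⟩, rfl⟩
  generalize hw : monomialBasis n p (γ, η) = w at hv ⊢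
  have h1 : columnSum I v - z • columnTerm I R w = columnSum I (v - z • w)
      + z • ∑ C ∈ Finset.univ.erase R, columnTerm I C w := by
    have h3 : columnSum I w = columnTerm I R w
        + ∑ C ∈ Finset.univ.erase R, columnTerm I C w := by
      rw [columnSum, LinearMap.sum_apply, ← Finset.add_sum_erase _ _ (Finset.mem_univ R)]
    rw [LinearMap.map_sub, LinearMap.map_smul, h3, smul_add, sub_add_eq_sub_sub, sub_add_cancel]
  rw [h1]
  refine Submodule.add_mem _ ?_ (Submodule.smul_mem _ _ (Submodule.sum_mem _ fun C hC => ?_))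
  · rw [columnSum, LinearMap.sum_apply]
    exact Submodule.sum_mem _ fun C _ => columnTerm_mem_dominated_of_mem hI C.injective hR hv
  · rw [← hw]
    exact columnTerm_mem_dominated_of_ne hI C.injective hR
      (DFunLike.coe_injective.ne (Finset.ne_of_mem_erase hC)) γ η

theorem prod_ofFn_X_mem_L {k : ℕ} (I : Fin k → Fin n) {v : CliffPoly n p} (hv : v ∈ L n p) :
    (List.ofFn fun r => (X (I r) : Module.End ℂ (CliffPoly n p))).prod v ∈ L n p := by
  induction k with
  | zero => simpa using hv
  | succ k ih =>
    rw [List.ofFn_succ, List.prod_cons, Module.End.mul_apply]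
    exact X_mem_L _ (ih fun r => I r.succ)

theorem columnOp_mem_L {k : ℕ} (I : Fin k → Fin n) {v : CliffPoly n p} (hv : v ∈ L n p) :
    columnOp I v ∈ L n p := by
  rw [columnOp, LinearMap.sum_apply]
  exact Submodule.sum_mem _ fun σ _ =>
    Submodule.smul_mem _ _ (prod_ofFn_X_mem_L (fun r => I (σ r)) hv)

end Columns

/-! ### Combinatorics of tableaux -/

namespace Tableau

variable {n p : ℕ}

theorem mem_subshape {A : Tableau n p} {k r c : ℕ} :
    (r, c) ∈ A.subshape k ↔ (r, c) ∈ A.shape ∧ A.entry r c < k := by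
  rw [← YoungDiagram.mem_cells]
  simp [subshape]

/-- The entry of a box is the least k for which the box lies in the (k + 1)-st subshape. -/
theorem ext_of_subshape {A B : Tableau n p}
    (h : ∀ k ∈ Finset.Icc 1 n, A.subshape k = B.subshape k) : A = B := by
  have key : ∀ {A B : Tableau n p}, (∀ k ∈ Finset.Icc 1 n, A.subshape k = B.subshape k) →
      ∀ r c, (r, c) ∈ A.shape → (r, c) ∈ B.shape ∧ B.entry r c ≤ A.entry r c := by
    intro A B h r c hA
    have h1 : (r, c) ∈ A.subshape (A.entry r c + 1) := mem_subshape.mpr ⟨hA, Nat.lt_succ_self _⟩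
    rw [h _ (Finset.mem_Icc.mpr ⟨by omega, A.entry_lt hA⟩)] at h1
    obtain ⟨h2, h3⟩ := mem_subshape.mp h1
    exact ⟨h2, by omega⟩
  have hAB := key h
  have hBA := key fun k hk => (h k hk).symm
  obtain ⟨sA, eA, hA1, hA2⟩ := A
  obtain ⟨sB, eB, hB1, hB2⟩ := B
  have hs : sA = sB := by
    ext ⟨r, c⟩
    exact ⟨fun h => (hAB r c h).1, fun h => (hBA r c h).1⟩
  subst hs
  have he : eA = eB := by
    refine SemistandardYoungTableau.ext fun r c => ?_
    by_cases hrc : (r, c) ∈ sA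
    · exact le_antisymm (hBA r c hrc).2 (hAB r c hrc).2
    · rw [eA.zeros hrc, eB.zeros hrc]
  subst he
  rfl

/-- The exponents of the leading term of `ω̃_A(p)`. -/
def exponent (A : Tableau n p) : Fin n × Fin p →₀ ℕ :=
  ∑ b : A.shape.cells, Finsupp.single
    ((⟨A.entry b.1.1 b.1.2, A.entry_lt ((YoungDiagram.mem_cells _).mp b.2)⟩ : Fin n),
      A.rowFilling b) 1

theorem exponent_apply (A : Tableau n p) (i : Fin n) (α : Fin p) :
    A.exponent (i, α) = ∑ b ∈ A.shape.cells, if A.entry b.1 b.2 = i ∧ b.1 = (α : ℕ) then 1 else 0 := by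
  classical
  rw [← Finset.sum_coe_sort, exponent, Finsupp.finsetSum_apply]
  refine Finset.sum_congr rfl fun b _ => ?_
  rw [Finsupp.single_apply]
  simp [Prod.ext_iff, Fin.ext_iff, rowFilling]

/-- A box in row α with entry i contributes x_{i,α}, so a corner sum counts the boxes in the first r
rows with entry less than k. This links dominance of monomials to the order on tableaux. -/
theorem cornerSum_exponent (A : Tableau n p) (k r : ℕ) :
    cornerSum A.exponent k r = ∑ α ∈ Finset.range r, (A.subshape k).rowLen α := by
  classical
  have h1 : cornerSum A.exponent k r
      = ∑ b ∈ A.shape.cells, if A.entry b.1 b.2 < k ∧ b.1 < r then 1 else 0 := by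
    rw [← Finset.sum_coe_sort, exponent, cornerSum_sum, Finset.card_filter]
    rfl
  have h2 : A.shape.cells.filter (fun b => A.entry b.1 b.2 < k ∧ b.1 < r)
      = (A.subshape k).cells.filter fun b => b.1 < r := by
    ext b
    simp [subshape, and_assoc]
  rw [h1, ← Finset.card_filter, h2, Finset.card_eq_sum_card_fiberwise (f := Prod.fst)
    (t := Finset.range r) (fun b hb => by simpa using (Finset.mem_filter.mp hb).2)]
  refine Finset.sum_congr rfl fun α hα => ?_
  rw [YoungDiagram.rowLen_eq_card, YoungDiagram.row, Finset.filter_filter]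
  congr 1
  refine Finset.filter_congr fun b _ => ⟨fun h => h.2, fun h => ⟨?_, h⟩⟩
  rw [h]
  exact Finset.mem_range.mp hα

theorem rowDegree_exponent (A : Tableau n p) : rowDegree A.exponent = A.weight := by
  classical
  funext i
  rw [rowDegree, weight, Finset.card_filter]
  simp only [exponent_apply]
  rw [Finset.sum_comm]
  refine Finset.sum_congr rfl fun b hb => ?_
  rw [Finset.sum_eq_single (A.rowFilling ⟨b, hb⟩)]
  · simp [rowFilling]
  · intro α _ hα
    rw [if_neg]
    rintro ⟨_, h⟩
    exact hα (Fin.ext h.symm)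
  · simp

theorem eq_of_rowLen {κ ν : YoungDiagram} (h : ∀ j, κ.rowLen j = ν.rowLen j) : κ = ν := by
  ext ⟨r, c⟩
  rw [YoungDiagram.mem_cells, YoungDiagram.mem_cells, YoungDiagram.mem_iff_lt_rowLen,
    YoungDiagram.mem_iff_lt_rowLen, h]

theorem exponent_injective : Function.Injective (exponent : Tableau n p → _) := by
  intro A B h
  refine ext_of_subshape fun k _ => eq_of_rowLen fun j => ?_
  have h1 := cornerSum_exponent A k (j + 1)
  have h2 := cornerSum_exponent A k j
  rw [h, cornerSum_exponent, Finset.sum_range_succ, Finset.sum_range_succ] at h1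
  rw [h, cornerSum_exponent] at h2
  omega

theorem card_subshape (A : Tableau n p) (k : ℕ) :
    (A.subshape k).card = ∑ i : Fin n, if (i : ℕ) < k then A.weight i else 0 := by
  classical
  have h : (A.subshape k).card = ∑ i ∈ Finset.univ.filter (fun i : Fin n => (i : ℕ) < k),
      A.weight i := by
    have h1 : (A.subshape k).card = ∑ b ∈ A.shape.cells, if A.entry b.1 b.2 < k then 1 else 0 := by
      rw [← Finset.card_filter]
      rfl
    rw [h1]
    simp only [weight, Finset.card_filter]
    rw [Finset.sum_comm]
    refine Finset.sum_congr rfl fun b hb => ?_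
    have hlt := A.entry_lt ((YoungDiagram.mem_cells b).mp hb)
    rw [Finset.sum_filter, Finset.sum_eq_single (⟨A.entry b.1 b.2, hlt⟩ : Fin n)]
    · simp
    · intro i _ hi
      have : ¬ A.entry b.1 b.2 = i := fun h => hi (Fin.ext h.symm)
      simp [this]
    · simp
  rw [h, Finset.sum_filter]

/-- The shapes of the subtableaux as an element of a linearly ordered set. -/
def shapeKey (A : Tableau n p) : Lex (Fin n → Lex (ℕ → ℕ)) :=
  toLex fun k => toLex fun j => (A.subshape (k + 1)).rowLen j

theorem shapeKey_injective : Function.Injective (shapeKey : Tableau n p → _) := by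
  intro A B h
  refine ext_of_subshape fun k hk => eq_of_rowLen fun j => ?_
  obtain ⟨h1, h2⟩ := Finset.mem_Icc.mp hk
  have h3 := congrFun (toLex.injective (congrFun (toLex.injective h) ⟨k - 1, by omega⟩)) j
  simpa [Nat.sub_add_cancel h1] using h3

/-- Tableaux of equal weight have subshapes of equal sizes, so the grading never decides and the
order is purely lexicographic. -/
theorem lt_iff_shapeKey_lt {A B : Tableau n p} (h : A.weight = B.weight) :
    A < B ↔ A.shapeKey < B.shapeKey := by
  have hcard : ∀ k, (A.subshape k).card = (B.subshape k).card := by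
    intro k
    rw [card_subshape, card_subshape, h]
  have h1 : A < B ↔ ∃ k ∈ Finset.Icc 1 n,
      (∀ l ∈ Finset.Icc 1 n, l < k → A.subshape l = B.subshape l) ∧
        partitionLT (A.subshape k) (B.subshape k) := by
    constructor
    · rintro (h' | ⟨_, h'⟩)
      · rw [h] at h'
        rcases h' with h' | ⟨_, j, _, h'⟩ <;> exact absurd h' (lt_irrefl _)
      · exact h'
    · exact fun h' => Or.inr ⟨h, h'⟩
  rw [h1]
  constructor
  · rintro ⟨k, hk, h2, h3⟩
    obtain ⟨hk1, hk2⟩ := Finset.mem_Icc.mp hk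
    refine ⟨⟨k - 1, by omega⟩, fun l hl => ?_, ?_⟩
    · have hl' : (l : ℕ) < k - 1 := hl
      change toLex _ = toLex _
      simp only
      rw [h2 (l + 1) (Finset.mem_Icc.mpr ⟨by omega, by omega⟩) (by omega)]
    · rcases h3 with h3 | ⟨_, j, h4, h5⟩
      · exact absurd (hcard k) h3.ne
      · have hk' : k - 1 + 1 = k := by omega
        refine ⟨j, fun i hi => ?_, ?_⟩
        · change (A.subshape (k - 1 + 1)).rowLen i = (B.subshape (k - 1 + 1)).rowLen i
          rw [hk', h4 i hi]
        · change (A.subshape (k - 1 + 1)).rowLen j < (B.subshape (k - 1 + 1)).rowLen j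
          rw [hk']
          exact h5
  · rintro ⟨k, h2, j, h3, h4⟩
    refine ⟨k + 1, Finset.mem_Icc.mpr ⟨by omega, k.isLt⟩, fun l hl hlk => ?_,
      Or.inr ⟨hcard _, j, h3, h4⟩⟩
    obtain ⟨hl1, hl2⟩ := Finset.mem_Icc.mp hl
    refine eq_of_rowLen fun j => ?_
    have h5 := congrFun (toLex.injective (h2 ⟨l - 1, by omega⟩ 
      (Fin.lt_def.mpr (show l - 1 < (k : ℕ) by omega)))) j
    simpa [Nat.sub_add_cancel hl1] using h5

/-- At the first differing row of the first differing subshape, the corner sums differ only by that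
row length. -/
theorem not_lt_of_cornerSum_le {A B : Tableau n p} (h : A.weight = B.weight)
    (hle : cornerSum A.exponent ≤ cornerSum B.exponent) : ¬ B < A := by
  intro hlt
  rw [lt_iff_shapeKey_lt h.symm] at hlt
  obtain ⟨k, _, j, h3, h4⟩ := hlt
  have h5 : cornerSum A.exponent (k + 1) (j + 1) ≤ cornerSum B.exponent (k + 1) (j + 1) :=
    hle _ _
  rw [cornerSum_exponent, cornerSum_exponent, Finset.sum_range_succ, Finset.sum_range_succ] at h5
  have h6 : ∑ i ∈ Finset.range j, (B.subshape (k + 1)).rowLen i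
      = ∑ i ∈ Finset.range j, (A.subshape (k + 1)).rowLen i :=
    Finset.sum_congr rfl fun i hi => h3 i (Finset.mem_range.mp hi)
  have h7 : (B.subshape (k + 1)).rowLen j < (A.subshape (k + 1)).rowLen j := h4
  omega

theorem finite_weight_eq (μ : Fin n → ℕ) : {A : Tableau n p | A.weight = μ}.Finite := by
  refine Set.Finite.of_finite_image (f := exponent) ?_ exponent_injective.injOn
  refine (Set.finite_Iic (Finsupp.equivFunOnFinite.symm fun x : Fin n × Fin p => μ x.1)).subset ?_
  rintro _ ⟨A, hA, rfl⟩ ⟨i, α⟩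
  have h : rowDegree A.exponent i = μ i := by rw [rowDegree_exponent, hA]
  rw [rowDegree] at h
  rw [Finsupp.equivFunOnFinite_symm_apply_apply, ← h]
  exact Finset.single_le_sum (f := fun α => A.exponent (i, α)) (fun _ _ => Nat.zero_le _)
    (Finset.mem_univ α)

theorem exists_isEnumeration (μ : Fin n → ℕ) :
    ∃ (m : ℕ) (A : Fin m → Tableau n p), IsEnumeration μ A := by
  classical
  have hfin := finite_weight_eq (n := n) (p := p) μ
  set s : Finset (Lex (Fin n → Lex (ℕ → ℕ))) := hfin.toFinset.image shapeKey with hs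
  have hex : ∀ k : Fin s.card, ∃ A : Tableau n p, A.weight = μ ∧
      A.shapeKey = s.orderEmbOfFin rfl k := by
    intro k
    have := s.orderEmbOfFin_mem rfl k
    obtain ⟨A, hA, h⟩ := Finset.mem_image.mp this
    exact ⟨A, (Set.Finite.mem_toFinset hfin).mp hA, h⟩
  choose A hA hk using hex
  refine ⟨s.card, A, fun k l hkl => ?_, ?_⟩
  · rw [lt_iff_shapeKey_lt ((hA k).trans (hA l).symm), hk, hk]
    exact (s.orderEmbOfFin rfl).strictMono hkl
  · ext T
    constructor
    · rintro ⟨k, rfl⟩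
      exact hA k
    · intro hT
      have h1 : T.shapeKey ∈ Set.range (s.orderEmbOfFin rfl) := by
        rw [Finset.range_orderEmbOfFin, hs]
        exact Finset.mem_coe.mpr
          (Finset.mem_image_of_mem _ ((Set.Finite.mem_toFinset hfin).mpr hT))
      obtain ⟨k, hk'⟩ := h1
      exact ⟨k, shapeKey_injective ((hk k).trans hk')⟩

/-- The tableau is forced: `H k r` must be the number of entries less than k in row r, so the entry
in column c is the least k with c < `H (k + 1) r`. The hypothesis becomes `H (k + 1) (r + 1) ≤ H k
r`, which is strictness down the columns and also makes the row lengths decrease. -/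
theorem exists_exponent_eq (γ : Fin n × Fin p →₀ ℕ)
    (hγ : ∀ α β : Fin p, (α : ℕ) + 1 = β → ∀ k,
      ∑ i ∈ Finset.Iic k, γ (i, β) ≤ ∑ i ∈ Finset.Iio k, γ (i, α)) :
    ∃ A : Tableau n p, A.exponent = γ := by
  classical
  set H : ℕ → ℕ → ℕ := fun k r =>
    ∑ i : Fin n, if (i : ℕ) < k then (if h : r < p then γ (i, ⟨r, h⟩) else 0) else 0 with hH
  have hmono : ∀ r, Monotone fun k => H k r := by
    intro r k l hkl
    refine Finset.sum_le_sum fun i _ => ?_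
    by_cases h1 : (i : ℕ) < k
    · rw [if_pos h1, if_pos (h1.trans_le hkl)]
    · rw [if_neg h1]; exact Nat.zero_le _
  have hzero : ∀ r, H 0 r = 0 := fun r => by simp [hH]
  have hp : ∀ k r, p ≤ r → H k r = 0 := fun k r hr => by simp [hH, not_lt.mpr hr]
  have htop : ∀ k r, H k r ≤ H n r := by
    intro k r
    refine Finset.sum_le_sum fun i _ => ?_
    rw [if_pos i.isLt]
    split_ifs <;> simp
  have hsucc : ∀ (i : Fin n) (α : Fin p), H (i + 1) α = H i α + γ (i, α) := by
    intro i α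
    simp only [hH, α.isLt, dif_pos, Fin.eta]
    have h1 : γ (i, α) = ∑ j : Fin n, if j = i then γ (j, α) else 0 := by simp
    rw [h1, ← Finset.sum_add_distrib]
    refine Finset.sum_congr rfl fun j _ => ?_
    by_cases h1 : j = i
    · subst h1; simp
    · have h2 : (j : ℕ) ≠ i := fun h => h1 (Fin.ext h)
      simp only [h1, if_false, add_zero]
      congr 1
      exact propext ⟨fun h => by omega, fun h => by omega⟩
  have hlat' : ∀ k r, k < n → H (k + 1) (r + 1) ≤ H k r := by
    intro k r hk
    by_cases hr : r + 1 < p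
    · have h1 := hγ ⟨r, by omega⟩ ⟨r + 1, hr⟩ rfl ⟨k, hk⟩
      rw [← Finset.filter_ge_eq_Iic, Finset.sum_filter, ← Finset.filter_gt_eq_Iio,
        Finset.sum_filter] at h1
      refine le_trans (le_of_eq (Finset.sum_congr rfl fun i _ => ?_))
        (h1.trans (le_of_eq (Finset.sum_congr rfl fun i _ => ?_)))
      · rw [dif_pos hr]
        exact if_congr (by rw [Fin.le_def]; exact Nat.lt_succ_iff) rfl rfl
      · rw [dif_pos (by omega : r < p)]
        exact if_congr Fin.lt_def rfl rfl
    · rw [hp _ _ (by omega)]; exact Nat.zero_le _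
  -- Beyond k = n nothing is added to `H`, so the inequality at k = n - 1 suffices there.
  have hlat : ∀ k r, H (k + 1) (r + 1) ≤ H k r := by
    intro k r
    by_cases hk : k < n
    · exact hlat' k r hk
    · refine (htop _ _).trans ?_
      cases n with
      | zero => rw [hzero]; exact Nat.zero_le _
      | succ n => exact (hlat' n r (Nat.lt_succ_self _)).trans (hmono r (by omega))
  have hanti : ∀ k, Antitone (H k) := fun k =>
    antitone_nat_of_succ_le fun r => (hmono (r + 1) (Nat.le_succ k)).trans (hlat k r)
  let sh : YoungDiagram :=
    { cells := (Finset.range p ×ˢ Finset.range (H n 0)).filter fun b => b.2 < H n b.1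
      isLowerSet := by
        rintro ⟨r, c⟩ ⟨r', c'⟩ hle h
        obtain ⟨hr, hc⟩ := Prod.mk_le_mk.mp hle
        simp only [Finset.coe_filter, Finset.mem_product, Finset.mem_range,
          Set.mem_ofPred_eq] at h ⊢
        have := hanti n hr
        omega }
  have hmem : ∀ r c, (r, c) ∈ sh ↔ c < H n r := by
    intro r c
    rw [← YoungDiagram.mem_cells]
    simp only [sh, Finset.mem_filter, Finset.mem_product, Finset.mem_range]
    refine ⟨fun h => h.2, fun h => ⟨⟨?_, h.trans_le (hanti n (Nat.zero_le r))⟩, h⟩⟩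
    by_contra hr
    rw [hp n r (by omega)] at h
    omega
  let ent : ℕ → ℕ → ℕ := fun r c => if h : ∃ k, c < H (k + 1) r then Nat.find h else 0
  have hent : ∀ r c k, (r, c) ∈ sh → (ent r c < k ↔ c < H k r) := by
    intro r c k h
    rw [hmem] at h
    have hex : ∃ k, c < H (k + 1) r := ⟨n, h.trans_le (hmono r (Nat.le_succ n))⟩
    simp only [ent, dif_pos hex]
    constructor
    · intro h1
      exact (Nat.find_spec hex).trans_le (hmono r h1)
    · intro h1
      cases k with
      | zero => rw [hzero] at h1; omega
      | succ k => exact Nat.lt_succ_of_le (Nat.find_min' hex h1)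
  let T : SemistandardYoungTableau sh :=
    { entry := ent
      row_weak' := by
        intro r c1 c2 hc h
        have h1 : (r, c1) ∈ sh := sh.up_left_mem le_rfl hc.le h
        have h2 := (hent r c2 (ent r c2 + 1) h).mp (Nat.lt_succ_self _)
        exact Nat.lt_succ_iff.mp ((hent r c1 _ h1).mpr (hc.trans h2))
      col_strict' := by
        intro r1 r2 c hr h
        have h1 : (r1, c) ∈ sh := sh.up_left_mem hr.le le_rfl h
        have h2 := (hent r2 c (ent r2 c + 1) h).mp (Nat.lt_succ_self _)
        exact (hent r1 c _ h1).mpr (h2.trans_le ((hanti _ hr).trans (hlat _ _)))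
      zeros' := by
        intro r c h
        rw [hmem] at h
        refine dif_neg ?_
        rintro ⟨k, hk⟩
        exact h (hk.trans_le (htop _ _)) }
  refine ⟨⟨sh, T, fun {r c} h => (hent r c n h).mpr ((hmem r c).mp h), ?_⟩, ?_⟩
  · by_contra! h
    have := (hmem p 0).mp (YoungDiagram.mem_iff_lt_colLen.mpr h)
    rw [hp n p le_rfl] at this
    omega
  · ext ⟨i, α⟩
    rw [exponent_apply, ← Finset.card_filter]
    have h1 : sh.cells.filter (fun b => T b.1 b.2 = i ∧ b.1 = (α : ℕ))
        = {(α : ℕ)} ×ˢ Finset.Ico (H i α) (H (i + 1) α) := by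
      ext ⟨r, c⟩
      simp only [Finset.mem_filter, YoungDiagram.mem_cells, Finset.mem_product,
        Finset.mem_singleton, Finset.mem_Ico]
      have hT : T r c = ent r c := rfl
      constructor
      · rintro ⟨h1, h2, rfl⟩
        rw [hT] at h2
        have h3 := hent α c i h1
        have h4 := hent α c (i + 1) h1
        refine ⟨rfl, ?_, h4.mp (by omega)⟩
        by_contra! h5
        have := h3.mpr h5
        omega
      · rintro ⟨rfl, h1, h2⟩
        have h0 : ((α : ℕ), c) ∈ sh := (hmem _ _).mpr (h2.trans_le (htop _ _))
        have h3 := hent α c i h0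
        have h4 := hent α c (i + 1) h0
        refine ⟨h0, ?_, rfl⟩
        rw [hT]
        have := h4.mpr h2
        have : ¬ ent α c < i := fun h => absurd (h3.mp h) (by omega)
        omega
    change (sh.cells.filter (fun b => T b.1 b.2 = i ∧ b.1 = (α : ℕ))).card = _
    rw [h1, Finset.card_product, Finset.card_singleton, Nat.card_Ico, hsucc]
    omega

end Tableau

/-! ### Tableau vectors and their leading terms -/

namespace Tableau

variable {n p : ℕ}

theorem column_strictMono (A : Tableau n p) (c : ℕ) : StrictMono (A.column c) := by
  intro r s hrs
  exact A.entry.col_strict hrs (YoungDiagram.mem_iff_lt_colLen.mpr s.isLt)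

/-- The numbers of the rows that meet the `c`-th column. -/
def columnRows (A : Tableau n p) (c : ℕ) (r : Fin (A.shape.colLen c)) : Fin p :=
  ⟨r, r.isLt.trans_le ((A.shape.colLen_anti 0 c (Nat.zero_le _)).trans A.length_le)⟩

/-- The part of the leading term that comes from the first `m` columns. -/
def leadingPart (A : Tableau n p) (m : ℕ) : CliffPoly n p :=
  (List.range m).foldl (fun v c => columnTerm (A.column c) (A.columnRows c) v) (vac n p)

/-- The exponents of `leadingPart`. -/
def partExponent (A : Tableau n p) (m : ℕ) : Fin n × Fin p →₀ ℕ :=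
  ∑ c ∈ Finset.range m, columnExponent (A.column c) (A.columnRows c)

/-- The normalized vector of the tableau formed by the first `m` columns. -/
def omegaPart (A : Tableau n p) (m : ℕ) : CliffPoly n p :=
  (List.range m).foldl (fun v c => columnSum (A.column c) v) (vac n p)

theorem leadingPart_succ (A : Tableau n p) (m : ℕ) :
    A.leadingPart (m + 1) = columnTerm (A.column m) (A.columnRows m) (A.leadingPart m) := by
  simp [leadingPart, List.range_succ]

theorem omegaPart_succ (A : Tableau n p) (m : ℕ) :
    A.omegaPart (m + 1) = columnSum (A.column m) (A.omegaPart m) := by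
  simp [omegaPart, List.range_succ]

theorem columnRows_val (A : Tableau n p) (c : ℕ) (r : Fin (A.shape.colLen c)) :
    (A.columnRows c r : ℕ) = r :=
  rfl

theorem partExponent_succ (A : Tableau n p) (m : ℕ) :
    A.partExponent (m + 1)
      = A.partExponent m + columnExponent (A.column m) (A.columnRows m) :=
  Finset.sum_range_succ _ _

theorem leadingPart_eq_smul (A : Tableau n p) (m : ℕ) :
    ∃ z : ℤˣ, A.leadingPart m = ((z : ℤ) : ℂ) •
      monomialBasis n p (A.partExponent m, columnParity (A.partExponent m)) := by
  induction m with
  | zero =>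
    refine ⟨1, ?_⟩
    have : columnParity (0 : Fin n × Fin p →₀ ℕ) = 0 := by funext α; simp [columnParity]
    simp [leadingPart, partExponent, vac_eq, this]
  | succ m ih =>
    obtain ⟨z, hz⟩ := ih
    obtain ⟨z', η, h1, h2⟩ := columnTerm_monomialBasis (A.column m) (A.columnRows m)
      (A.partExponent m, columnParity (A.partExponent m))
    refine ⟨z * z', ?_⟩
    rw [leadingPart_succ, hz, map_smul, h2, h1 rfl, smul_smul, partExponent_succ]
    push_cast
    rfl

theorem leadingPart_eq_tmul (A : Tableau n p) (m : ℕ) :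
    A.leadingPart m = MvPolynomial.monomial (A.partExponent m) 1 ⊗ₜ[ℂ]
      (List.ofFn fun c : Fin m =>
        (List.ofFn fun r => (e (A.columnRows c r) : Cl p)).prod).reverse.prod := by
  induction m with
  | zero => simp [leadingPart, partExponent, vac]
  | succ m ih =>
    rw [leadingPart_succ, ih, columnTerm_eq_map, TensorProduct.map_tmul, LinearMap.mulLeft_apply,
      LinearMap.mulLeft_apply, MvPolynomial.monomial_mul, one_mul, partExponent_succ,
      add_comm (A.partExponent m), List.ofFn_succ', List.concat_eq_append, List.reverse_append,
      List.reverse_singleton, List.singleton_append, List.prod_cons]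
    rfl

theorem omegaPart_sub_leadingPart_mem (A : Tableau n p) (m : ℕ) :
    A.omegaPart m - A.leadingPart m ∈ supportedOn (dominated (A.partExponent m)) := by
  induction m with
  | zero =>
    rw [show A.omegaPart 0 = A.leadingPart 0 from rfl, sub_self]
    exact Submodule.zero_mem _
  | succ m ih =>
    obtain ⟨z, hz⟩ := leadingPart_eq_smul A m
    rw [hz] at ih
    have h := columnSum_sub_mem (R := A.columnRows m) (A.column_strictMono m)
      (A.columnRows_val m) _ ih
    have h' : A.leadingPart (m + 1) = ((z : ℤ) : ℂ) • columnTerm (A.column m) (A.columnRows m)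
        (monomialBasis n p (A.partExponent m, columnParity (A.partExponent m))) := by
      rw [leadingPart_succ, hz]
      exact LinearMap.map_smul _ _ _
    rw [omegaPart_succ, h', partExponent_succ]
    exact h

theorem omegaPart_mem_integralVectors (A : Tableau n p) (m : ℕ) :
    A.omegaPart m ∈ integralVectors n p := by
  induction m with
  | zero =>
    rw [show A.omegaPart 0 = vac n p from rfl, vac_eq]
    exact monomialBasis_mem_integralVectors _
  | succ m ih =>
    rw [omegaPart_succ]
    exact columnSum_mem_integralVectors _ ih

theorem omegaTilde_eq (A : Tableau n p) : A.omegaTilde = A.omegaPart (A.shape.rowLen 0) := by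
  have h : ∀ m, (List.range m).foldl (fun v c => columnOp (A.column c) v) (vac n p)
      = (∏ c ∈ Finset.range m, ((A.shape.colLen c).factorial : ℂ)) • A.omegaPart m := by
    intro m
    induction m with
    | zero => simp [omegaPart]
    | succ m ih =>
      rw [List.range_succ, List.foldl_append, ih, List.foldl_cons, List.foldl_nil, columnOp_eq,
        map_smul, LinearMap.smul_apply, smul_smul, Finset.prod_range_succ, omegaPart_succ]
  have hne : (A.shapeFactorial : ℂ) ≠ 0 := by
    rw [shapeFactorial, Nat.cast_ne_zero, Finset.prod_ne_zero_iff]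
    exact fun c _ => Nat.factorial_ne_zero _
  rw [omegaTilde, omega, h, smul_smul, shapeFactorial] at *
  rw [Nat.cast_prod] at *
  rw [inv_mul_cancel₀ hne, one_smul]

theorem sum_cells (κ : YoungDiagram) (g : ℕ × ℕ → ℕ) :
    ∑ b ∈ κ.cells, g b
      = ∑ c ∈ Finset.range (κ.rowLen 0), ∑ r ∈ Finset.range (κ.colLen c), g (r, c) := by
  rw [← Finset.sum_fiberwise_of_maps_to (g := Prod.snd) (t := Finset.range (κ.rowLen 0))]
  · refine Finset.sum_congr rfl fun c _ => ?_
    have : κ.cells.filter (fun b => b.2 = c) = κ.col c := rfl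
    rw [this, YoungDiagram.col_eq_prod, Finset.sum_product]
    simp
  · rintro ⟨r, c⟩ hb
    rw [Finset.mem_range, ← YoungDiagram.mem_iff_lt_rowLen]
    exact κ.up_left_mem (Nat.zero_le _) le_rfl ((YoungDiagram.mem_cells _).mp hb)

theorem partExponent_eq (A : Tableau n p) : A.partExponent (A.shape.rowLen 0) = A.exponent := by
  classical
  ext ⟨i, α⟩
  rw [exponent_apply, sum_cells, partExponent, Finsupp.finsetSum_apply]
  refine Finset.sum_congr rfl fun c _ => ?_
  rw [columnExponent, Finsupp.finsetSum_apply, Finset.sum_range]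
  refine Finset.sum_congr rfl fun r _ => ?_
  rw [Finsupp.single_apply]
  simp [Prod.ext_iff, Fin.ext_iff, columnRows, column]

theorem leadingTerm_eq (A : Tableau n p) :
    A.leadingTerm = A.leadingPart (A.shape.rowLen 0) := by
  rw [leadingPart_eq_tmul, partExponent_eq, leadingTerm, exponent, MvPolynomial.monomial_sum_one]
  rfl

theorem leadingTerm_eq_smul (A : Tableau n p) :
    ∃ z : ℤˣ, A.leadingTerm
      = ((z : ℤ) : ℂ) • monomialBasis n p (A.exponent, columnParity A.exponent) := by
  obtain ⟨z, hz⟩ := A.leadingPart_eq_smul (A.shape.rowLen 0)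
  exact ⟨z, by rw [leadingTerm_eq, hz, partExponent_eq]⟩

theorem omegaTilde_sub_leadingTerm_mem (A : Tableau n p) :
    A.omegaTilde - A.leadingTerm ∈ supportedOn (dominated A.exponent) := by
  rw [omegaTilde_eq, leadingTerm_eq, ← partExponent_eq]
  exact omegaPart_sub_leadingPart_mem A _

theorem omegaTilde_mem_integralVectors (A : Tableau n p) :
    A.omegaTilde ∈ integralVectors n p := by
  rw [omegaTilde_eq]
  exact omegaPart_mem_integralVectors A _

theorem omegaTilde_mem_L (A : Tableau n p) : A.omegaTilde ∈ L n p := by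
  refine Submodule.smul_mem _ _ ?_
  rw [omega]
  generalize A.shape.rowLen 0 = m
  induction m with
  | zero => exact vac_mem_L
  | succ m ih =>
    rw [List.range_succ, List.foldl_append, List.foldl_cons, List.foldl_nil]
    exact columnOp_mem_L _ ih

theorem omegaTilde_mem_weightSpace (A : Tableau n p) :
    A.omegaTilde ∈ weightSpace n p A.weight := by
  refine mem_weightSpace.mpr ⟨A.omegaTilde_mem_L, ?_⟩
  have h1 : A.leadingTerm ∈ supportedOn {b : MonomialIndex n p | rowDegree b.1 = A.weight} := by
    obtain ⟨z, hz⟩ := A.leadingTerm_eq_smul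
    rw [hz]
    exact Submodule.smul_mem _ _ (monomialBasis_mem_supportedOn A.rowDegree_exponent)
  have h2 := supportedOn_mono (S' := {b : MonomialIndex n p | rowDegree b.1 = A.weight})
    (fun b hb => hb.2.trans A.rowDegree_exponent) A.omegaTilde_sub_leadingTerm_mem
  have h3 := Submodule.add_mem _ h2 h1
  rwa [sub_add_cancel] at h3

end Tableau

/-! ### Leading coefficients: triangularity, independence, completeness. -/

section Pairing

variable {n p : ℕ}

theorem pairing_add (u v w : CliffPoly n p) : pairing u (v + w) = pairing u v + pairing u w := by
  simp [pairing, mul_add, Finsupp.sum_add]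

theorem pairing_smul (u v : CliffPoly n p) (a : ℂ) : pairing u (a • v) = a * pairing u v := by
  simp only [pairing, map_smul, Finsupp.smul_apply, smul_eq_mul, Finsupp.mul_sum]
  refine Finsupp.sum_congr fun b _ => ?_
  ring

/-- The pairing with a fixed first argument as a linear form. -/
def pairingForm (u : CliffPoly n p) : CliffPoly n p →ₗ[ℂ] ℂ where
  toFun v := pairing u v
  map_add' := pairing_add u
  map_smul' a v := pairing_smul u v a

theorem pairingForm_apply (u v : CliffPoly n p) : pairingForm u v = pairing u v := rfl

theorem exists_pairing_leadingTerm (A : Tableau n p) :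
    ∃ z : ℤˣ, A.leadingTerm
        = ((z : ℤ) : ℂ) • monomialBasis n p (A.exponent, columnParity A.exponent) ∧
      ∀ v, pairing A.leadingTerm v
        = ((z : ℤ) : ℂ) * (monomialBasis n p).repr v (A.exponent, columnParity A.exponent) := by
  obtain ⟨z, hz⟩ := A.leadingTerm_eq_smul
  refine ⟨z, hz, fun v => ?_⟩
  rw [hz, pairing, map_smul, Module.Basis.repr_self, Finsupp.smul_single, smul_eq_mul, mul_one,
    Finsupp.sum_single_index (by simp)]
  simp

theorem pairing_leadingTerm_eq_intCast (A : Tableau n p) {v : CliffPoly n p}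
    (hv : v ∈ integralVectors n p) : ∃ z : ℤ, pairing A.leadingTerm v = z := by
  obtain ⟨z, _, hz⟩ := exists_pairing_leadingTerm A
  obtain ⟨z', hz'⟩ := hv (A.exponent, columnParity A.exponent)
  exact ⟨z * z', by rw [hz, hz', Int.cast_mul]⟩

theorem pairing_leadingTerm_omegaTilde_self (A : Tableau n p) :
    pairing A.leadingTerm A.omegaTilde = 1 := by
  obtain ⟨z, h1, h2⟩ := exists_pairing_leadingTerm A
  have h3 : (monomialBasis n p).repr (A.omegaTilde - A.leadingTerm)
      (A.exponent, columnParity A.exponent) = 0 := by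
    by_contra h
    exact lt_irrefl _ (mem_supportedOn.mp A.omegaTilde_sub_leadingTerm_mem _ h).1
  rw [map_sub, Finsupp.sub_apply, sub_eq_zero] at h3
  rw [h2, h3, h1, map_smul, Module.Basis.repr_self, Finsupp.smul_single, Finsupp.single_eq_same,
    smul_eq_mul, mul_one, ← Int.cast_mul, Int.units_coe_mul_self, Int.cast_one]

theorem dominated_of_pairing_ne_zero {A B : Tableau n p} (hAB : A ≠ B)
    (h : pairing A.leadingTerm B.omegaTilde ≠ 0) :
    cornerSum A.exponent < cornerSum B.exponent := by
  obtain ⟨z, _, h2⟩ := exists_pairing_leadingTerm A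
  obtain ⟨z', h1', _⟩ := exists_pairing_leadingTerm B
  have h3 : (monomialBasis n p).repr (B.omegaTilde - B.leadingTerm)
      (A.exponent, columnParity A.exponent) ≠ 0 := by
    rw [h2] at h
    rw [map_sub, Finsupp.sub_apply, h1', map_smul, Module.Basis.repr_self, Finsupp.smul_apply,
      Finsupp.single_apply, if_neg, smul_zero, sub_zero]
    · exact right_ne_zero_of_mul h
    · intro heq
      exact hAB (Tableau.exponent_injective (Prod.ext_iff.mp heq).1.symm)
  exact (mem_supportedOn.mp B.omegaTilde_sub_leadingTerm_mem _ h3).1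

/-- In a relation, choose a tableau whose corner sums are maximal: its leading term occurs in no
other vector of the relation, so its coefficient vanishes. Tableaux of different weights need no
separate treatment. -/
theorem omegaTilde_linearIndependent (c : Tableau n p →₀ ℂ)
    (hc : c.sum (fun B z => z • B.omegaTilde) = 0) : c = 0 := by
  classical
  by_contra h
  obtain ⟨_, hm⟩ := (c.support.image fun B : Tableau n p => cornerSum B.exponent).exists_maximal
    ((Finsupp.support_nonempty_iff.mpr h).image _)
  obtain ⟨A, hA, rfl⟩ := Finset.mem_image.mp hm.1
  have h1 : pairingForm A.leadingTerm (c.sum fun B z => z • B.omegaTilde) = c A := by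
    rw [Finsupp.sum, map_sum, Finset.sum_eq_single_of_mem A hA]
    · rw [map_smul, pairingForm_apply, pairing_leadingTerm_omegaTilde_self, smul_eq_mul, mul_one]
    · intro B hB hBA
      rw [map_smul, pairingForm_apply]
      by_contra hne
      exact hm.not_gt (Finset.mem_image_of_mem _ hB)
        (dominated_of_pairing_ne_zero hBA.symm (right_ne_zero_of_smul hne))
  rw [hc, map_zero] at h1
  exact Finsupp.mem_support_iff.mp hA h1.symm

/-- A nonzero v contains a lattice monomial. Its exponents come from a tableau, its row degrees give
that tableau weight μ, and parity fixes its Clifford factor; so it is a leading term up to sign. -/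
theorem eq_zero_of_pairing_leadingTerm {μ : Fin n → ℕ} {v : CliffPoly n p}
    (hv : v ∈ weightSpace n p μ)
    (h : ∀ A : Tableau n p, A.weight = μ → pairing A.leadingTerm v = 0) : v = 0 := by
  by_contra hv0
  obtain ⟨hL, hw⟩ := mem_weightSpace.mp hv
  obtain ⟨⟨γ, η⟩, hb, hlat⟩ := exists_lattice_monomial hL hv0
  obtain ⟨A, rfl⟩ := Tableau.exists_exponent_eq γ hlat
  have h1 : rowDegree A.exponent = μ := mem_supportedOn.mp hw _ hb
  have h2 : η = columnParity A.exponent := mem_supportedOn.mp (L_le_parity hL) _ hb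
  rw [Tableau.rowDegree_exponent] at h1
  obtain ⟨z, _, hz⟩ := exists_pairing_leadingTerm A
  have h3 := h A h1
  rw [hz, ← h2, mul_eq_zero] at h3
  rcases h3 with h3 | h3
  · simp at h3
  · exact hb h3

end Pairing

/-! ### Inversion of unitriangular matrices -/

section Chains

variable {d : ℕ}

theorem mem_chains {k : Fin d} {t : ℕ} {l : Fin (t + 1) → Fin d} :
    l ∈ chains k t ↔ l 0 = k ∧ StrictMono l := by
  simp [chains]

/-- A strictly increasing chain from k satisfies l_s ≥ k + s. Hence the range of t may be enlarged
to one independent of k. -/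
theorem chains_eq_empty {k : Fin d} {t : ℕ} (h : d ≤ t + k) : chains k t = ∅ := by
  rw [Finset.eq_empty_iff_forall_notMem]
  intro l hl
  obtain ⟨h0, hl⟩ := mem_chains.mp hl
  have key : ∀ s (hs : s < t + 1), (k : ℕ) + s ≤ l ⟨s, hs⟩ := by
    intro s
    induction s with
    | zero => intro hs; rw [← h0]; exact le_rfl
    | succ s ih =>
      intro hs
      have h1 := ih (by omega)
      have h2 : l ⟨s, by omega⟩ < l ⟨s + 1, hs⟩ := hl (by simp [Fin.lt_def])
      have := Fin.lt_def.mp h2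
      omega
  have := key t (Nat.lt_succ_self t)
  omega

theorem chains_zero (k : Fin d) : chains k 0 = {fun _ => k} := by
  ext l
  rw [mem_chains, Finset.mem_singleton]
  constructor
  · rintro ⟨h, _⟩
    funext i
    rw [show i = 0 from Fin.ext (by omega), h]
  · rintro rfl
    exact ⟨rfl, fun a b hab => absurd (Fin.lt_def.mp hab) (by omega)⟩

theorem sum_chains_succ {M : Type*} [AddCommMonoid M] (k : Fin d) (t : ℕ)
    (F : (Fin (t + 2) → Fin d) → M) :
    ∑ l ∈ chains k (t + 1), F l
      = ∑ j ∈ Finset.Ioi k, ∑ l ∈ chains j t, F (Fin.cons k l : Fin (t + 2) → Fin d) := by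
  rw [Finset.sum_sigma']
  refine Finset.sum_bij' (fun l _ => ⟨l 1, Fin.tail l⟩) (fun x _ => Fin.cons k x.2) ?_ ?_ ?_ ?_ ?_
  · intro l hl
    obtain ⟨h0, hl⟩ := mem_chains.mp hl
    rw [Finset.mem_sigma, Finset.mem_Ioi, mem_chains]
    exact ⟨h0 ▸ hl (by simp), rfl, fun a b hab => hl (Fin.succ_lt_succ_iff.mpr hab)⟩
  · rintro ⟨j, l⟩ hx
    rw [Finset.mem_sigma, Finset.mem_Ioi, mem_chains] at hx
    obtain ⟨hkj, h0, hl⟩ := hx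
    rw [mem_chains]
    refine ⟨rfl, Fin.strictMono_iff_lt_succ.mpr fun i => ?_⟩
    induction i using Fin.cases with
    | zero =>
      rw [Fin.castSucc_zero, Fin.cons_zero, Fin.cons_succ]
      simp only at h0 hkj ⊢
      rw [h0]
      exact hkj
    | succ i =>
      rw [← Fin.succ_castSucc, Fin.cons_succ, Fin.cons_succ]
      exact hl Fin.castSucc_lt_succ
  · intro l hl
    obtain ⟨h0, _⟩ := mem_chains.mp hl
    rw [← h0]
    exact Fin.cons_self_tail l
  · rintro ⟨j, l⟩ hx
    rw [Finset.mem_sigma, Finset.mem_Ioi, mem_chains] at hx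
    obtain ⟨_, h0, _⟩ := hx
    simp only at h0
    subst h0
    simp
  · intro l hl
    obtain ⟨h0, _⟩ := mem_chains.mp hl
    rw [← h0]
    exact congrArg F (Fin.cons_self_tail l).symm

/-- The coordinates `(U⁻¹ f)_k` as sums over chains. -/
def chainSum (U : Matrix (Fin d) (Fin d) ℂ) (f : Fin d → ℂ) (k : Fin d) : ℂ :=
  ∑ t ∈ Finset.range (d - (k : ℕ)), ∑ l ∈ chains k t,
    (-1 : ℂ) ^ t * (∏ s : Fin t, U (l s.castSucc) (l s.succ)) * f (l (Fin.last t))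

/-- Removing the first step of a chain shows that the terms of length t + 1 from k are -∑_{j > k}
U_{kj} times those of length t from j. Summed over t, this is back substitution: g_k = f_k - ∑_{j >
k} U_{kj} g_j. -/
theorem mulVec_chainSum {U : Matrix (Fin d) (Fin d) ℂ} (h1 : ∀ k, U k k = 1)
    (h0 : ∀ k l, l < k → U k l = 0) (f : Fin d → ℂ) : U.mulVec (chainSum U f) = f := by
  set h : Fin d → ℕ → ℂ := fun k t => ∑ l ∈ chains k t,
    (-1 : ℂ) ^ t * (∏ s : Fin t, U (l s.castSucc) (l s.succ)) * f (l (Fin.last t)) with hh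
  have hrange : ∀ k m, d ≤ m → chainSum U f k = ∑ t ∈ Finset.range m, h k t := by
    intro k m hm
    refine Finset.sum_subset (Finset.range_mono (by omega)) fun t _ ht => ?_
    rw [Finset.mem_range, not_lt] at ht
    rw [chains_eq_empty (by omega), Finset.sum_empty]
  have hzero : ∀ k, h k 0 = f k := by
    intro k
    simp [hh, chains_zero]
  have hsucc : ∀ k t, h k (t + 1) = - ∑ j ∈ Finset.Ioi k, U k j * h j t := by
    intro k t
    simp only [hh]
    rw [sum_chains_succ, ← Finset.sum_neg_distrib]
    refine Finset.sum_congr rfl fun j _ => ?_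
    rw [Finset.mul_sum, ← Finset.sum_neg_distrib]
    refine Finset.sum_congr rfl fun l hl => ?_
    obtain ⟨hl0, _⟩ := mem_chains.mp hl
    rw [Fin.prod_univ_succ, ← Fin.succ_last, Fin.cons_succ, Fin.castSucc_zero, Fin.cons_zero,
      Fin.cons_succ, hl0, pow_succ]
    simp only [← Fin.succ_castSucc, Fin.cons_succ]
    ring
  funext k
  have h2 : chainSum U f k = f k - ∑ j ∈ Finset.Ioi k, U k j * chainSum U f j := by
    rw [hrange k (d + 1) (by omega), Finset.sum_range_succ', hzero]
    simp only [hsucc]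
    rw [Finset.sum_neg_distrib, Finset.sum_comm, sub_eq_neg_add]
    congr 2
    refine Finset.sum_congr rfl fun j _ => ?_
    rw [hrange j d le_rfl, Finset.mul_sum]
  have h3 : U.mulVec (chainSum U f) k
      = chainSum U f k + ∑ j ∈ Finset.Ioi k, U k j * chainSum U f j := by
    have h4 : ∑ j ∈ Finset.Ici k, U k j * chainSum U f j
        = chainSum U f k + ∑ j ∈ Finset.Ioi k, U k j * chainSum U f j := by
      rw [← Finset.Ioi_insert, Finset.sum_insert (by simp), h1, one_mul]
    rw [← h4, Matrix.mulVec, dotProduct]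
    refine (Finset.sum_subset (Finset.subset_univ _) fun j _ hj => ?_).symm
    rw [Finset.mem_Ici, not_le] at hj
    rw [h0 k j hj, zero_mul]
  rw [h3, h2, sub_add_cancel]

theorem det_eq_one_of_unitriangular {U : Matrix (Fin d) (Fin d) ℂ} (h1 : ∀ k, U k k = 1)
    (h0 : ∀ k l, l < k → U k l = 0) : U.det = 1 := by
  rw [Matrix.det_of_isUpperTriangular (fun k l hkl => h0 k l hkl)]
  simp [h1]

theorem chainSum_eq_intCast {U : Matrix (Fin d) (Fin d) ℂ} {f : Fin d → ℂ}
    (hU : ∀ k l, ∃ z : ℤ, U k l = z) (hf : ∀ k, ∃ z : ℤ, f k = z) (k : Fin d) :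
    ∃ z : ℤ, chainSum U f k = z := by
  have h : chainSum U f k ∈ (Int.castRingHom ℂ).range := by
    have hU' : ∀ k l, U k l ∈ (Int.castRingHom ℂ).range := fun k l =>
      (hU k l).imp fun z hz => hz.symm
    have hf' : ∀ k, f k ∈ (Int.castRingHom ℂ).range := fun k => (hf k).imp fun z hz => hz.symm
    refine Subring.sum_mem _ fun t _ => Subring.sum_mem _ fun l _ => Subring.mul_mem _
      (Subring.mul_mem _ (Subring.pow_mem _ ?_ _) (Subring.prod_mem _ fun s _ => hU' _ _)) (hf' _)
    exact Subring.neg_mem _ (Subring.one_mem _)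
  obtain ⟨z, hz⟩ := h
  exact ⟨z, hz.symm⟩

end Chains

/-! ### Expansions in tableau vectors -/

section Expansion

variable {n p d : ℕ} {μ : Fin n → ℕ} {A : Fin d → Tableau n p}

theorem IsEnumeration.weight_eq (hA : IsEnumeration μ A) (k : Fin d) : (A k).weight = μ := by
  have : A k ∈ Set.range A := ⟨k, rfl⟩
  rw [hA.2] at this
  exact this

theorem transitionMatrix_self (k : Fin d) : transitionMatrix A k k = 1 :=
  pairing_leadingTerm_omegaTilde_self _

theorem transitionMatrix_eq_intCast (k l : Fin d) : ∃ z : ℤ, transitionMatrix A k l = z :=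
  pairing_leadingTerm_eq_intCast _ (Tableau.omegaTilde_mem_integralVectors _)

theorem transitionMatrix_of_lt (hA : IsEnumeration μ A) {k l : Fin d} (hkl : l < k) :
    transitionMatrix A k l = 0 := by
  by_contra h
  have hw : (A k).weight = (A l).weight := (hA.weight_eq k).trans (hA.weight_eq l).symm
  have hlt := hA.1 l k hkl
  have hne : A k ≠ A l := by
    intro heq
    rw [Tableau.lt_iff_shapeKey_lt hw.symm, heq] at hlt
    exact lt_irrefl _ hlt
  exact Tableau.not_lt_of_cornerSum_le hw (dominated_of_pairing_ne_zero hne h).le hlt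

theorem leadingCoeffs_sum (g : Fin d → ℂ) :
    leadingCoeffs A (∑ k, g k • (A k).omegaTilde) = (transitionMatrix A).mulVec g := by
  funext k
  rw [leadingCoeffs, ← pairingForm_apply, map_sum, Matrix.mulVec, dotProduct]
  refine Finset.sum_congr rfl fun l _ => ?_
  rw [map_smul, pairingForm_apply, smul_eq_mul, mul_comm]
  rfl

theorem sum_mem_weightSpace (hA : IsEnumeration μ A) (g : Fin d → ℂ) :
    ∑ k, g k • (A k).omegaTilde ∈ weightSpace n p μ := by
  refine Submodule.sum_mem _ fun k _ => Submodule.smul_mem _ _ ?_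
  rw [← hA.weight_eq k]
  exact Tableau.omegaTilde_mem_weightSpace _

theorem eq_of_leadingCoeffs_eq (hA : IsEnumeration μ A) {v w : CliffPoly n p}
    (hv : v ∈ weightSpace n p μ) (hw : w ∈ weightSpace n p μ)
    (h : leadingCoeffs A v = leadingCoeffs A w) : v = w := by
  rw [← sub_eq_zero]
  refine eq_zero_of_pairing_leadingTerm (Submodule.sub_mem _ hv hw) fun B hB => ?_
  have hB' : B ∈ Set.range A := by rw [hA.2]; exact hB
  obtain ⟨k, rfl⟩ := hB'
  rw [← pairingForm_apply, map_sub, sub_eq_zero]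
  exact congrFun h k

theorem eq_sum_of_mulVec_eq (hA : IsEnumeration μ A) {v : CliffPoly n p}
    (hv : v ∈ weightSpace n p μ) {g : Fin d → ℂ}
    (hg : (transitionMatrix A).mulVec g = leadingCoeffs A v) :
    v = ∑ k, g k • (A k).omegaTilde :=
  eq_of_leadingCoeffs_eq hA hv (sum_mem_weightSpace hA g) (by rw [leadingCoeffs_sum, hg])

theorem eq_sum_chainSum (hA : IsEnumeration μ A) {v : CliffPoly n p}
    (hv : v ∈ weightSpace n p μ) :
    v = ∑ k, chainSum (transitionMatrix A) (leadingCoeffs A v) k • (A k).omegaTilde :=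
  eq_sum_of_mulVec_eq hA hv (mulVec_chainSum transitionMatrix_self
    (fun _ _ h => transitionMatrix_of_lt hA h) _)

theorem eq_sum_inv_mulVec (hA : IsEnumeration μ A) {v : CliffPoly n p}
    (hv : v ∈ weightSpace n p μ) :
    v = ∑ k, ((transitionMatrix A)⁻¹.mulVec (leadingCoeffs A v)) k • (A k).omegaTilde := by
  refine eq_sum_of_mulVec_eq hA hv ?_
  rw [Matrix.mulVec_mulVec, Matrix.mul_nonsing_inv, Matrix.one_mulVec]
  rw [det_eq_one_of_unitriangular transitionMatrix_self fun _ _ h => transitionMatrix_of_lt hA h]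
  exact isUnit_one

/-- The leading coefficients define an isomorphism onto ℂ^d: injective by completeness, surjective
because the unitriangular system can be solved. -/
theorem dimWeight_eq (hA : IsEnumeration μ A) : dimWeight n p μ = d := by
  let φ : weightSpace n p μ →ₗ[ℂ] (Fin d → ℂ) :=
    (LinearMap.pi fun k => pairingForm (A k).leadingTerm) ∘ₗ (weightSpace n p μ).subtype
  have hφ : Function.Bijective φ := by
    constructor
    · intro v w h
      exact Subtype.ext (eq_of_leadingCoeffs_eq hA v.2 w.2 h)
    · intro f
      refine ⟨⟨_, sum_mem_weightSpace hA (chainSum (transitionMatrix A) f)⟩, ?_⟩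
      exact (leadingCoeffs_sum _).trans (mulVec_chainSum transitionMatrix_self
        (fun _ _ h => transitionMatrix_of_lt hA h) f)
  rw [dimWeight, (LinearEquiv.ofBijective φ hφ).finrank_eq, Module.finrank_fin_fun]

theorem exists_intCast_expansion {v : CliffPoly n p} (hv : v ∈ weightSpace n p μ)
    (hint : v ∈ integralVectors n p) :
    ∃ c : Tableau n p →₀ ℤ, v = c.sum (fun B z => (z : ℂ) • B.omegaTilde) := by
  obtain ⟨d, A, hA⟩ := Tableau.exists_isEnumeration (n := n) (p := p) μ
  have hz := chainSum_eq_intCast (U := transitionMatrix A) (f := leadingCoeffs A v)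
    transitionMatrix_eq_intCast (fun k => pairing_leadingTerm_eq_intCast _ hint)
  choose z hz using hz
  refine ⟨∑ k, Finsupp.single (A k) (z k), ?_⟩
  rw [← Finsupp.sum_finsetSum_index (by simp) (by intros; rw [Int.cast_add, add_smul])]
  conv_lhs => rw [eq_sum_chainSum hA hv]
  refine Finset.sum_congr rfl fun k _ => ?_
  rw [hz, Finsupp.sum_single_index (by simp)]

theorem existsUnique_intCast_expansion {v : CliffPoly n p} (hv : v ∈ weightSpace n p μ)
    (hint : v ∈ integralVectors n p) :
    ∃ c : Tableau n p →₀ ℤ, v = c.sum (fun B z => (z : ℂ) • B.omegaTilde) ∧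
      ∀ c' : Tableau n p →₀ ℂ, v = c'.sum (fun B z => z • B.omegaTilde) →
        ∀ B, c' B = (c B : ℂ) := by
  obtain ⟨c, hc⟩ := exists_intCast_expansion hv hint
  refine ⟨c, hc, fun c' hc' B => ?_⟩
  have h1 : (c' - c.mapRange (Int.cast : ℤ → ℂ) Int.cast_zero) = 0 := by
    refine omegaTilde_linearIndependent _ ?_
    have h3 : c.sum (fun B z => (z : ℂ) • B.omegaTilde)
        = Finsupp.linearCombination ℂ Tableau.omegaTilde
          (c.mapRange (Int.cast : ℤ → ℂ) Int.cast_zero) := by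
      rw [Finsupp.linearCombination_apply, Finsupp.sum_mapRange_index (by simp)]
    rw [← Finsupp.linearCombination_apply, map_sub, ← h3, ← hc, sub_eq_zero]
    exact hc'.symm
  have h2 := DFunLike.congr_fun h1 B
  rwa [Finsupp.sub_apply, Finsupp.mapRange_apply, Finsupp.zero_apply, sub_eq_zero] at h2

theorem X_mem_weightSpace (i : Fin n) {v : CliffPoly n p} (hv : v ∈ weightSpace n p μ) :
    X i v ∈ weightSpace n p (μ + Pi.single i 1) := by
  obtain ⟨h1, h2⟩ := mem_weightSpace.mp hv
  refine mem_weightSpace.mpr ⟨X_mem_L i h1, X_mem_supportedOn i (fun b hb α => ?_) h2⟩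
  have hb' : rowDegree b.1 = μ := hb
  rw [← hb']
  exact (rowDegree_add _ _).trans (by rw [rowDegree_single])

/-- If μ_i = 0 the subtraction truncates, but then no variable of row i occurs in v and D_i v = 0.
-/
theorem D_mem_weightSpace (i : Fin n) {v : CliffPoly n p} (hv : v ∈ weightSpace n p μ) :
    D i v ∈ weightSpace n p (μ - Pi.single i 1) := by
  obtain ⟨h1, h2⟩ := mem_weightSpace.mp hv
  refine mem_weightSpace.mpr ⟨D_mem_L i h1, D_mem_supportedOn i (fun b hb α h0 => ?_) h2⟩
  have hb' : rowDegree b.1 = μ := hb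
  have h3 := rowDegree_add (b.1 - Finsupp.single (i, α) 1) (Finsupp.single (i, α) 1)
  rw [tsub_add_cancel_of_le (by rw [Finsupp.single_le_iff]; omega), rowDegree_single, hb'] at h3
  change rowDegree (b.1 - Finsupp.single (i, α) 1) = _
  rw [h3, add_tsub_cancel_right]

end Expansion

end

end Paraboson

open Paraboson in
theorem proposition6p1 (n p : ℕ) (hn : 0 < n) (hp : 0 < p) :
    -- for every weight, the tableaux are `d_μ` in number
    (∀ μ : Fin n → ℕ, ∃ A : Fin (dimWeight n p μ) → Tableau n p, IsEnumeration μ A) ∧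
    (∀ (μ : Fin n → ℕ) (A : Fin (dimWeight n p μ) → Tableau n p), IsEnumeration μ A →
      -- `U_μ` is an integer matrix
      (∀ k l, ∃ z : ℤ, transitionMatrix A k l = (z : ℂ)) ∧
      -- `U_μ` is upper unitriangular
      (∀ k, transitionMatrix A k k = 1) ∧
      (∀ k l, l < k → transitionMatrix A k l = 0) ∧
      -- the expansion of the vectors of weight `μ + p/2`
      (∀ v ∈ weightSpace n p μ,
        v = ∑ k, ((transitionMatrix A)⁻¹.mulVec (leadingCoeffs A v)) k • (A k).omegaTilde ∧
        v = ∑ k : Fin (dimWeight n p μ),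
              ∑ t ∈ Finset.range (dimWeight n p μ - (k : ℕ)), ∑ l ∈ chains k t,
                ((-1 : ℂ) ^ t * (∏ s : Fin t, transitionMatrix A (l s.castSucc) (l s.succ)) *
                  leadingCoeffs A v (l (Fin.last t))) • (A k).omegaTilde)) ∧
    -- the coefficients in the expansions of `X_i ω̃_A` and `D_i ω̃_A` are well defined integers
    (∀ (i : Fin n) (A : Tableau n p), ∀ F ∈ ({X i, D i} : Set (Module.End ℂ (CliffPoly n p))),
      ∃ c : Tableau n p →₀ ℤ,
        F A.omegaTilde = c.sum (fun B z => (z : ℂ) • B.omegaTilde) ∧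
        ∀ c' : Tableau n p →₀ ℂ, F A.omegaTilde = c'.sum (fun B z => z • B.omegaTilde) →
          ∀ B, c' B = (c B : ℂ)) := by
  refine ⟨fun μ => ?_, fun μ A hA => ⟨transitionMatrix_eq_intCast, transitionMatrix_self,
    fun k l h => transitionMatrix_of_lt hA h, fun v hv => ⟨eq_sum_inv_mulVec hA hv, ?_⟩⟩,
    fun i A F hF => ?_⟩
  · obtain ⟨d, A, hA⟩ := Tableau.exists_isEnumeration (n := n) (p := p) μ
    obtain rfl := dimWeight_eq hA
    exact ⟨A, hA⟩
  · conv_lhs => rw [eq_sum_chainSum hA hv]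
    refine Finset.sum_congr rfl fun k _ => ?_
    rw [chainSum, Finset.sum_smul]
    exact Finset.sum_congr rfl fun t _ => Finset.sum_smul
  · rcases hF with rfl | rfl
    · exact existsUnique_intCast_expansion (X_mem_weightSpace i A.omegaTilde_mem_weightSpace)
        (X_mem_integralVectors i A.omegaTilde_mem_integralVectors)
    · exact existsUnique_intCast_expansion (D_mem_weightSpace i A.omegaTilde_mem_weightSpace)
        (D_mem_integralVectors i A.omegaTilde_mem_integralVectors)
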